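/- **Language and syntax.** Fix a first-order language $\mathscr L$: a set $\mathscr L_q$ of quantifier symbols and, for each $n\in\omega$, a set $\mathscr L_n$ of $n$-ary connectives, with a designated binary connective $\otimes$ and a designated constant $e$. A signature $Sg$ consists of sorts, function symbols $f:\sigma_1,\dots,\sigma_n\to\tau$ and relation symbols $R\subseteq\sigma_1,\dots,\sigma_n$; it is small if these form sets. Terms-in-context $M:\tau\ [\Gamma]$ and formulas-in-context $\phi\ [\Gamma]$ (with equality, the connectives, and quantifiers $\Omega_{x:\sigma}$, $\Omega\in\mathscr L_q$) are formed as usual and identified up to renaming of variables. An $Sg$-assertion is an equation $M=N:\tau\ [\Gamma]$ or a sequent $\phi_1,\dots,\phi_n\vdash\psi\ [\Gamma]$ $(n\ge 0)$; an $Sg$-theory is a set of $Sg$-assertions. A logic $\mathcal L$ is a closure operator $T\mapsto T_{\mathcal L}$ on the lattice of $Sg$-theories, for each signature $Sg$, whose closed theories are closed under the rules of typed equational logic (reflexivity, symmetry, transitivity, substitution of equals for variables in equations). **Prop-categories.** An object $(\mathcal C,P)$ of $\mathbf{FA}$ is a category $\mathcal C$ with designated finite products and a functor $P:\mathcal C^{op}\to\mathbf{Pos}$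 such that: (1) each $P(c)$ carries operations interpreting all connectives and each $P(f)$ preserves them (no monotonicity is required of the operations); (2) for each $c$ there is a designated element $Eq_c\in P(c\times c)$; (3) for each $\Omega\in\mathscr L_q$ there are maps $\Omega_{b,c}:P(b\times c)\to P(b)$, not necessarily monotone, natural in $b$; (4) $(P(c),\otimes,e)$ is a monoid; (5) $\Omega_{b,1}\circ P(\pi_1)=\mathrm{id}$ and $\Omega_{b,c\times d}\circ P(a_{b,c,d})=\Omega_{b,c}\circ\Omega_{b\times c,d}$, where $a_{b,c,d}:b\times(c\times d)\cong(b\times c)\times d$; (6) $Eq_1=e$, and for $c=c_1\times c_2$, $Eq_c=P(\langle\pi_1\pi^{c,c}_1,\pi_1\pi^{c,c}_2\rangle)Eq_{c_1}\otimes P(\langle\pi_2\pi^{c,c}_1,\pi_2\pi^{c,c}_2\rangle)Eq_{c_2}$, where $\pi_i:c\to c_i$ and $\pi^{c,c}_i:c\times c\to c$ are the projections. A morphism $F:(\mathcal C,P)\to(\mathcal D,Q)$ of $\mathbf{FA}$ is a finite-product-preserving functor $F^o:\mathcal C\to\mathcal D$ with a natural transformation $F^p:P\Rightarrow Q\circ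 F^o$ by monotone maps that preserves the connectives and, modulo the canonical isomorphisms $F^o(b\times c)\cong F^ob\times F^oc$, the quantifiers and the elements $Eq_c$. It is a subprop-morphism if $F^o$ is faithful and every $F^p_c$ is an order embedding. Products in $\mathbf{FA}$ are formed componentwise. **Structures and soundness.** An $Sg$-structure $S$ in $(\mathcal C,P)$ assigns an object to each sort, a morphism from the product of the argument objects to each function symbol, and an element of the corresponding fibre to each relation symbol. Terms and formulas in context $\Gamma$ are interpreted recursively as morphisms out of $S[\![\Gamma]\!]$ and elements of $P(S[\![\Gamma]\!])$, where $S[\![\Gamma]\!]$ is the product of the objects of the sorts of $\Gamma$, equality being interpreted by $P(\langle M,N\rangle)Eq$ and quantifiers by $\Omega_{S[\![\Gamma]\!],S[\![\sigma]\!]}$. $S$ satisfies $M=N$ if the interpretations are equal, and $\phi_1,\dots,\phi_n\vdash\psi\ [\Gamma]$ if $S[\![\phi_1]\!]\otimes\cdots\otimes S[\![\phi_n]\!]\le S[\![\psi]\!]$ (the left side being $e$ if $n=0$). $\mathbf{FA}_{\mathcal L}$ is the full subcategory of $\mathbf{FA}$ on those $(\mathcal C,P)$ in which $\mathcal L$ is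 sound: for every signature and all theories $T'\subseteq T_{\mathcal L}$, every $T$-model in $(\mathcal C,P)$ is a $T'$-model. **The formula prop-category.** Let $Sg$ be small and let $T_0$ be the least $Sg$-theory closed under the rules of equational logic and the following rules: $\phi\vdash\phi$; from $\phi\vdash\psi$ and $\psi\vdash\theta$ infer $\phi\vdash\theta$; weakening of the context of a sequent; from $M=M'$ and $\Phi\vdash\psi$ infer $\Phi[M/x]\vdash\psi[M'/x]$; from $\phi\vdash\psi\ [\Gamma,x:\sigma]$ and $\psi\vdash\phi\ [\Gamma,x:\sigma]$ infer $\Omega_{x:\sigma}\phi\vdash\Omega_{x:\sigma}\psi\ [\Gamma]$; from $\phi_i\vdash\phi_i'$ and $\phi_i'\vdash\phi_i$ for all $i$ infer $\Diamond(\phi_1,\dots,\phi_n)\vdash\Diamond(\phi'_1,\dots,\phi'_n)$ for each $n$-ary connective $\Diamond$; and, in both directions, $\Phi,\alpha,\beta,\Psi\vdash\theta$ iff $\Phi,\alpha\otimes\beta,\Psi\vdash\theta$, and $\Phi,e,\Psi\vdash\theta$ iff $\Phi,\Psi\vdash\theta$. The prop-category $(\mathcal C_{Sg},P_{Sg})\in\mathbf{FA}$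 has contexts as objects, lists of terms up to provable equality in $T_0$ as morphisms, concatenation of contexts as products, and $P_{Sg}(\Gamma)$ is the set of formulas in context $\Gamma$ up to interderivability in $T_0$, ordered by $\phi\le\psi$ iff $(\phi\vdash\psi\ [\Gamma])\in T_0$; $P_{Sg}$ acts on morphisms by substitution, connectives are syntactic, $\Omega_{\Gamma,\Delta}$ is iterated quantification over the variables of $\Delta$, and $Eq_\Gamma$ is the $\otimes$-product of the equations $x_i=y_i$. Its generic structure $G$ interprets each sort $\sigma$ as the context $x:\sigma$, each $f$ as the term $f(x_1,\dots,x_n)$ and each $R$ as the formula $R(x_1,\dots,x_n)$. **Models and theories.** Let $\mathrm{Mod}^{\mathcal L}_{Sg}$ be the class of all morphisms $F:(\mathcal C_{Sg},P_{Sg})\to(\mathcal C,P)$ of $\mathbf{FA}$ with $(\mathcal C,P)\in\mathbf{FA}_{\mathcal L}$. For an assertion $a$ write $G[\![a]\!]\in\ker F$ if: $F^o(G[\![M]\!])=F^o(G[\![N]\!])$, when $a$ is $M=N:\tau\ [\Gamma]$; $F^p(G[\![\phi_1]\!]\otimes\cdots\otimes G[\![\phi_n]\!])\le F^p(G[\![\psi]\!])$,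 when $a$ is $\phi_1,\dots,\phi_n\vdash\psi\ [\Gamma]$. For $\mathcal Y\subseteq\mathrm{Mod}^{\mathcal L}_{Sg}$ and an $Sg$-theory $T$ put $$\mathrm{Th}(\mathcal Y)=\{a: G[\![a]\!]\in\ker F\text{ for all }F\in\mathcal Y\},\qquad \mathrm{Mod}_T=\{F\in\mathrm{Mod}^{\mathcal L}_{Sg}: G[\![a]\!]\in\ker F\text{ for all }a\in T\}.$$ **Operations.** The external product of a family $F_i:(\mathcal C_{Sg},P_{Sg})\to(\mathcal C_i,P_i)$ $(i\in I$, $I$ a possibly empty set$)$ is $\langle F_i\rangle_{i\in I}:(\mathcal C_{Sg},P_{Sg})\to(\prod_i\mathcal C_i,\prod_iP_i)$. If $F=\iota\circ K$ with $K:(\mathcal C_{Sg},P_{Sg})\to(\mathcal E,R)$, $(\mathcal E,R)\in\mathbf{FA}_{\mathcal L}$ and $\iota$ a subprop-morphism of $\mathbf{FA}_{\mathcal L}$, then $K$ is an external submodel of $F$. If $H:(\mathcal C,P)\to(\mathcal D,Q)$ is a morphism of $\mathbf{FA}_{\mathcal L}$ and $F:(\mathcal C_{Sg},P_{Sg})\to(\mathcal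 C,P)$, then $H\circ F$ is an external homomorphic image of $F$. Let $\mathbb P(\mathcal Y)$, $\mathbb S(\mathcal Y)$, $\mathbb H(\mathcal Y)$ be the least classes containing $\mathcal Y$ and closed under external products, submodels and homomorphic images, respectively. **Theorem (fibered HSP theorem).** Let $\mathcal L$ be a logic and $Sg$ a small signature. For every class $\mathcal Y\subseteq\mathrm{Mod}^{\mathcal L}_{Sg}$, $$\mathrm{Mod}_{\mathrm{Th}(\mathcal Y)}=\mathbb H\,\mathbb S\,\mathbb P(\mathcal Y).$$ -/

import Mathlib

open CategoryTheory MonoidalCategory CartesianMonoidalCategory Opposite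

universe u s v w p v₁ w₁ p₁ v₂ w₂ p₂ v₃ w₃ p₃

namespace FibHSP

/-! ## First-order languages, signatures, terms and formulas in context -/

/-- A first-order language: quantifier symbols and finitary propositional connectives, with a
designated binary connective `⊗` and a designated nullary connective `e`. -/
structure Language where
  /-- quantifier symbols -/
  Quant : Type u
  /-- connectives of each arity -/
  Conn : ℕ → Type u
  /-- the connective `⊗` -/
  tensor : Conn 2
  /-- the connective `e` -/
  unit : Conn 0

/-- A many-sorted signature. Lists of sorts are read as contexts, see `Var`. -/
structure Signature where
  /-- sort symbols -/
  Srt : Type s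
  /-- function symbols `f : dom f → cod f` -/
  Func : Type s
  /-- argument sorts of a function symbol -/
  dom : Func → List Srt
  /-- value sort of a function symbol -/
  cod : Func → Srt
  /-- relation symbols `R ⊆ ar R` -/
  Rel : Type s
  /-- argument sorts of a relation symbol -/
  ar : Rel → List Srt

/-- A context (up to renaming of its variables) is a list of sorts, whose *head* is the sort of the
*last* declared variable: `σ :: Γ` is the context `Γ, x : σ`.
`Var Γ σ` is the type of variables of sort `σ` of the context `Γ` (de Bruijn indices). -/
inductive Var {S : Type s} : List S → S → Type s
  | zero {Γ : List S} {σ : S} : Var (σ :: Γ) σ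
  | succ {Γ : List S} {σ τ : S} (x : Var Γ σ) : Var (τ :: Γ) σ

/-- `Term Sg Γ τ` is the type of terms-in-context `M : τ [Γ]`. -/
inductive Term (Sg : Signature.{s}) (Γ : List Sg.Srt) : Sg.Srt → Type s
  | var {σ : Sg.Srt} (x : Var Γ σ) : Term Sg Γ σ
  | app (f : Sg.Func) (args : ∀ σ, Var (Sg.dom f) σ → Term Sg Γ σ) : Term Sg Γ (Sg.cod f)

/-- `Subst Sg Γ Δ` is the type of lists of terms in context `Γ`, one for each variable of `Δ`. -/
def Subst (Sg : Signature.{s}) (Γ Δ : List Sg.Srt) : Type s :=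
  ∀ σ, Var Δ σ → Term Sg Γ σ

/-- Formulas-in-context, up to renaming of free and bound variables. -/
inductive Formula (L : Language.{u}) (Sg : Signature.{s}) : List Sg.Srt → Type (max u s)
  | rel {Γ : List Sg.Srt} (R : Sg.Rel) (args : ∀ σ, Var (Sg.ar R) σ → Term Sg Γ σ) :
      Formula L Sg Γ
  | eq {Γ : List Sg.Srt} {σ : Sg.Srt} (M N : Term Sg Γ σ) : Formula L Sg Γ
  | conn {Γ : List Sg.Srt} {n : ℕ} (c : L.Conn n) (φ : Fin n → Formula L Sg Γ) : Formula L Sg Γ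
  | quant {Γ : List Sg.Srt} (Q : L.Quant) (σ : Sg.Srt) (φ : Formula L Sg (σ :: Γ)) :
      Formula L Sg Γ

/-- Assertions: equations-in-context `M = N : τ [Γ]` and sequents-in-context
`φ₁, …, φₙ ⊢ ψ [Γ]`. -/
inductive Assertion (L : Language.{u}) (Sg : Signature.{s}) : Type (max u s)
  | eqn {Γ : List Sg.Srt} {τ : Sg.Srt} (M N : Term Sg Γ τ) : Assertion L Sg
  | seq {Γ : List Sg.Srt} (Φ : List (Formula L Sg Γ)) (ψ : Formula L Sg Γ) : Assertion L Sg

/-- `Sg`-theories, ordered by inclusion. -/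
abbrev Theory (L : Language.{u}) (Sg : Signature.{s}) : Type (max u s) := Set (Assertion L Sg)

section Substitution

variable {L : Language.{u}} {Sg : Signature.{s}}

/-- Renaming of variables in a term. -/
def Term.ren {Γ Δ : List Sg.Srt} (ρ : ∀ σ, Var Δ σ → Var Γ σ) :
    ∀ {τ : Sg.Srt}, Term Sg Δ τ → Term Sg Γ τ
  | _, .var x => .var (ρ _ x)
  | _, .app f a => .app f fun σ x => (a σ x).ren ρ

/-- Weakening of a term by one variable. -/
def Term.wk {Γ : List Sg.Srt} {τ : Sg.Srt} (σ : Sg.Srt) (M : Term Sg Γ τ) :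
    Term Sg (σ :: Γ) τ :=
  M.ren fun _ x => x.succ

/-- Simultaneous substitution in a term. -/
def Term.subst {Γ Δ : List Sg.Srt} (γ : Subst Sg Γ Δ) :
    ∀ {τ : Sg.Srt}, Term Sg Δ τ → Term Sg Γ τ
  | _, .var x => γ _ x
  | _, .app f a => .app f fun σ x => (a σ x).subst γ

/-- The substitution `(γ, x)` of `Δ, x : σ` in context `Γ, x : σ`. -/
def Subst.lift {Γ Δ : List Sg.Srt} (γ : Subst Sg Γ Δ) (σ : Sg.Srt) :
    Subst Sg (σ :: Γ) (σ :: Δ)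
  | _, .zero => .var .zero
  | _, .succ x => (γ _ x).wk σ

/-- The identity substitution. -/
def Subst.id (Γ : List Sg.Srt) : Subst Sg Γ Γ := fun _ x => .var x

/-- Componentwise substitution of one list of terms in another. -/
def Subst.comp {Γ Δ Θ : List Sg.Srt} (γ : Subst Sg Γ Δ) (δ : Subst Sg Δ Θ) : Subst Sg Γ Θ :=
  fun σ x => (δ σ x).subst γ

/-- Simultaneous (capture-avoiding) substitution in a formula. -/
def Formula.subst : ∀ {Γ Δ : List Sg.Srt}, Subst Sg Γ Δ → Formula L Sg Δ → Formula L Sg Γ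
  | _, _, γ, .rel R a => .rel R fun σ x => (a σ x).subst γ
  | _, _, γ, .eq M N => .eq (M.subst γ) (N.subst γ)
  | _, _, γ, .conn c φ => .conn c fun i => (φ i).subst γ
  | _, _, γ, .quant Q σ φ => .quant Q σ (φ.subst (γ.lift σ))

/-- The formula `φ ⊗ ψ`. -/
def Formula.tens {Γ : List Sg.Srt} (φ ψ : Formula L Sg Γ) : Formula L Sg Γ :=
  .conn L.tensor ![φ, ψ]

/-- The formula `e`. -/
def Formula.one (Γ : List Sg.Srt) : Formula L Sg Γ := .conn L.unit ![]

/-! ### Elementary facts on substitution -/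

theorem Term.ren_ren {Γ Δ Θ : List Sg.Srt} (ρ : ∀ σ, Var Δ σ → Var Γ σ)
    (ρ' : ∀ σ, Var Θ σ → Var Δ σ) {τ : Sg.Srt} (M : Term Sg Θ τ) :
    (M.ren ρ').ren ρ = M.ren fun σ x => ρ σ (ρ' σ x) := by
  induction M with
  | var x => rfl
  | app f a ih => simp only [Term.ren]; congr; funext σ x; exact ih σ x

theorem Term.subst_ren {Γ Δ Θ : List Sg.Srt} (γ : Subst Sg Γ Δ)
    (ρ : ∀ σ, Var Θ σ → Var Δ σ) {τ : Sg.Srt} (M : Term Sg Θ τ) :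
    (M.ren ρ).subst γ = M.subst fun σ x => γ σ (ρ σ x) := by
  induction M with
  | var x => rfl
  | app f a ih => simp only [Term.ren, Term.subst]; congr; funext σ x; exact ih σ x

theorem Term.ren_subst {Γ Δ Θ : List Sg.Srt} (ρ : ∀ σ, Var Δ σ → Var Γ σ)
    (γ : Subst Sg Δ Θ) {τ : Sg.Srt} (M : Term Sg Θ τ) :
    (M.subst γ).ren ρ = M.subst fun σ x => (γ σ x).ren ρ := by
  induction M with
  | var x => rfl
  | app f a ih => simp only [Term.ren, Term.subst]; congr; funext σ x; exact ih σ x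

theorem Term.ren_eq_subst {Γ Δ : List Sg.Srt} (ρ : ∀ σ, Var Δ σ → Var Γ σ) {τ : Sg.Srt}
    (M : Term Sg Δ τ) : M.ren ρ = M.subst fun _ x => .var (ρ _ x) := by
  induction M with
  | var x => rfl
  | app f a ih => simp only [Term.ren, Term.subst]; congr; funext σ x; exact ih σ x

theorem Term.subst_id {Γ : List Sg.Srt} {τ : Sg.Srt} (M : Term Sg Γ τ) :
    M.subst (Subst.id Γ) = M := by
  induction M with
  | var x => rfl
  | app f a ih => simp only [Term.subst]; congr; funext σ x; exact ih σ x

theorem Term.subst_subst {Γ Δ Θ : List Sg.Srt} (γ : Subst Sg Γ Δ) (δ : Subst Sg Δ Θ)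
    {τ : Sg.Srt} (M : Term Sg Θ τ) : (M.subst δ).subst γ = M.subst (γ.comp δ) := by
  induction M with
  | var x => rfl
  | app f a ih => simp only [Term.subst]; congr; funext σ x; exact ih σ x

theorem Subst.lift_id (Γ : List Sg.Srt) (σ : Sg.Srt) :
    (Subst.id Γ).lift σ = Subst.id (Sg := Sg) (σ :: Γ) := by
  funext τ x; cases x <;> rfl

theorem Subst.lift_comp {Γ Δ Θ : List Sg.Srt} (γ : Subst Sg Γ Δ) (δ : Subst Sg Δ Θ)
    (σ : Sg.Srt) : (γ.comp δ).lift σ = (γ.lift σ).comp (δ.lift σ) := by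
  funext τ x
  cases x with
  | zero => rfl
  | succ x =>
    change ((δ _ x).subst γ).wk σ = ((δ _ x).wk σ).subst (γ.lift σ)
    simp only [Term.wk, Term.subst_ren, Term.ren_subst]
    rfl

theorem Formula.subst_id {Γ : List Sg.Srt} (φ : Formula L Sg Γ) :
    φ.subst (Subst.id Γ) = φ := by
  induction φ with
  | rel R a => simp only [Formula.subst, Term.subst_id]
  | eq M N => simp only [Formula.subst, Term.subst_id]
  | conn c φ ih => simp only [Formula.subst, ih]
  | quant Q σ φ ih => simp only [Formula.subst, Subst.lift_id, ih]

theorem Formula.subst_subst {Θ : List Sg.Srt} (φ : Formula L Sg Θ) :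
    ∀ {Γ Δ : List Sg.Srt} (γ : Subst Sg Γ Δ) (δ : Subst Sg Δ Θ),
      (φ.subst δ).subst γ = φ.subst (γ.comp δ) := by
  induction φ with
  | rel R a => intros; simp only [Formula.subst, Term.subst_subst]
  | eq M N => intros; simp only [Formula.subst, Term.subst_subst]
  | conn c φ ih => intros; simp only [Formula.subst, ih]
  | quant Q σ φ ih => intros; simp only [Formula.subst, Subst.lift_comp, ih]

theorem Formula.subst_tens {Γ Δ : List Sg.Srt} (γ : Subst Sg Γ Δ) (φ ψ : Formula L Sg Δ) :
    (φ.tens ψ).subst γ = (φ.subst γ).tens (ψ.subst γ) := by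
  simp only [Formula.tens, Formula.subst]
  congr; funext i; fin_cases i <;> rfl

theorem Formula.subst_one {Γ Δ : List Sg.Srt} (γ : Subst Sg Γ Δ) :
    (Formula.one Δ : Formula L Sg Δ).subst γ = Formula.one Γ := by
  simp only [Formula.one, Formula.subst]
  congr; funext i; exact i.elim0

end Substitution

/-! ## Rules: typed equational logic, the minimal logic, and logics -/

/-- `T` is closed under the rules of typed equational logic. Substitution is stated for
simultaneous substitutions `γ = γ'` of lists of terms. -/
structure EqClosed {L : Language.{u}} {Sg : Signature.{s}} (T : Theory L Sg) : Prop where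
  refl : ∀ {Γ : List Sg.Srt} {τ : Sg.Srt} (M : Term Sg Γ τ), .eqn M M ∈ T
  symm : ∀ {Γ : List Sg.Srt} {τ : Sg.Srt} {M N : Term Sg Γ τ}, .eqn M N ∈ T → .eqn N M ∈ T
  trans : ∀ {Γ : List Sg.Srt} {τ : Sg.Srt} {M N K : Term Sg Γ τ},
    .eqn M N ∈ T → .eqn N K ∈ T → .eqn M K ∈ T
  subst : ∀ {Γ Δ : List Sg.Srt} {τ : Sg.Srt} {γ γ' : Subst Sg Γ Δ} {M N : Term Sg Δ τ},
    (∀ σ x, .eqn (γ σ x) (γ' σ x) ∈ T) → .eqn M N ∈ T → .eqn (M.subst γ) (N.subst γ') ∈ T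

/-- `T` is closed under the rules of the minimal logic: the rules of equational logic, axiom,
cut, context weakening and substitution (combined in the single rule `sub` for simultaneous
substitutions), congruence rules for quantifiers and connectives, and the reflection rules for
`⊗` and `e`. -/
structure LmClosed {L : Language.{u}} {Sg : Signature.{s}} (T : Theory L Sg) : Prop
    extends EqClosed T where
  ax : ∀ {Γ : List Sg.Srt} (φ : Formula L Sg Γ), .seq [φ] φ ∈ T
  cut : ∀ {Γ : List Sg.Srt} {φ ψ θ : Formula L Sg Γ},
    .seq [φ] ψ ∈ T → .seq [ψ] θ ∈ T → .seq [φ] θ ∈ T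
  sub : ∀ {Γ Δ : List Sg.Srt} {γ γ' : Subst Sg Γ Δ} {Φ : List (Formula L Sg Δ)}
    {ψ : Formula L Sg Δ}, (∀ σ x, .eqn (γ σ x) (γ' σ x) ∈ T) → .seq Φ ψ ∈ T →
    .seq (Φ.map fun φ => φ.subst γ) (ψ.subst γ') ∈ T
  quant_con : ∀ {Γ : List Sg.Srt} (Q : L.Quant) (σ : Sg.Srt) {φ ψ : Formula L Sg (σ :: Γ)},
    .seq [φ] ψ ∈ T → .seq [ψ] φ ∈ T → .seq [.quant Q σ φ] (.quant Q σ ψ) ∈ T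
  conn_cong : ∀ {Γ : List Sg.Srt} {n : ℕ} (c : L.Conn n) {φ ψ : Fin n → Formula L Sg Γ},
    (∀ i, .seq [φ i] (ψ i) ∈ T) → (∀ i, .seq [ψ i] (φ i) ∈ T) →
    .seq [.conn c φ] (.conn c ψ) ∈ T
  tensor_ref : ∀ {Γ : List Sg.Srt} (Φ Ψ : List (Formula L Sg Γ)) (α β θ : Formula L Sg Γ),
    .seq (Φ ++ α :: β :: Ψ) θ ∈ T ↔ .seq (Φ ++ α.tens β :: Ψ) θ ∈ T
  unit_ref : ∀ {Γ : List Sg.Srt} (Φ Ψ : List (Formula L Sg Γ)) (θ : Formula L Sg Γ),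
    .seq (Φ ++ Formula.one Γ :: Ψ) θ ∈ T ↔ .seq (Φ ++ Ψ) θ ∈ T

/-- The least `Sg`-theory of the minimal logic. -/
def minTheory (L : Language.{u}) (Sg : Signature.{s}) : Theory L Sg :=
  {a | ∀ T : Theory L Sg, LmClosed T → a ∈ T}

theorem minTheory_closed (L : Language.{u}) (Sg : Signature.{s}) :
    LmClosed (minTheory L Sg) where
  refl M T hT := hT.refl M
  symm h T hT := hT.symm (h T hT)
  trans h h' T hT := hT.trans (h T hT) (h' T hT)
  subst h h' T hT := hT.subst (fun σ x => h σ x T hT) (h' T hT)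
  ax φ T hT := hT.ax φ
  cut h h' T hT := hT.cut (h T hT) (h' T hT)
  sub h h' T hT := hT.sub (fun σ x => h σ x T hT) (h' T hT)
  quant_con Q σ _ _ h h' T hT := hT.quant_con Q σ (h T hT) (h' T hT)
  conn_cong c _ _ h h' T hT := hT.conn_cong c (fun i => h i T hT) (fun i => h' i T hT)
  tensor_ref Φ Ψ α β θ :=
    ⟨fun h T hT => (hT.tensor_ref Φ Ψ α β θ).1 (h T hT),
      fun h T hT => (hT.tensor_ref Φ Ψ α β θ).2 (h T hT)⟩
  unit_ref Φ Ψ θ :=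
    ⟨fun h T hT => (hT.unit_ref Φ Ψ θ).1 (h T hT),
      fun h T hT => (hT.unit_ref Φ Ψ θ).2 (h T hT)⟩

/-- A (first-order) logic: a closure operator on the complete lattice of `Sg`-theories for each
signature `Sg`, whose closed theories satisfy the rules of equational logic. -/
structure Logic (L : Language.{u}) where
  /-- the deductive closure of a theory -/
  cl : ∀ Sg : Signature.{s}, ClosureOperator (Theory L Sg)
  eqClosed : ∀ (Sg : Signature.{s}) (T : Theory L Sg), EqClosed (cl Sg T)

/-! ## Prop-categories -/

/-- The objects of `FA`: a category with designated finite products, a contravariant functor `P`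
to posets, and interpretations of the connectives, equality and the quantifiers. -/
structure PropCat (L : Language.{u}) where
  /-- the base category -/
  C : Type v
  [cat : Category.{w} C]
  [cart : CartesianMonoidalCategory C]
  /-- the contravariant functor to posets -/
  P : Cᵒᵖ ⥤ PartOrd.{p}
  /-- connectives on each fibre -/
  conn : ∀ (c : C) {n : ℕ}, L.Conn n → (Fin n → P.obj (op c)) → P.obj (op c)
  map_conn : ∀ {c d : C} (f : c ⟶ d) {n : ℕ} (k : L.Conn n) (r : Fin n → P.obj (op d)),
    P.map f.op (conn d k r) = conn c k fun i => P.map f.op (r i)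
  /-- the designated equality predicate on `c` -/
  EqPred : ∀ c : C, P.obj (op (c ⊗ c))
  /-- the quantifiers `Q_{b,c} : P(b × c) → P(b)` -/
  quant : L.Quant → ∀ b c : C, P.obj (op (b ⊗ c)) → P.obj (op b)
  quant_natural : ∀ (Q : L.Quant) {b b' : C} (f : b' ⟶ b) (c : C) (r : P.obj (op (b ⊗ c))),
    quant Q b' c (P.map (f ▷ c).op r) = P.map f.op (quant Q b c r)
  tensor_assoc : ∀ (c : C) (x y z : P.obj (op c)),
    conn c L.tensor ![conn c L.tensor ![x, y], z] = conn c L.tensor ![x, conn c L.tensor ![y, z]]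
  unit_tensor : ∀ (c : C) (x : P.obj (op c)), conn c L.tensor ![conn c L.unit ![], x] = x
  tensor_unit : ∀ (c : C) (x : P.obj (op c)), conn c L.tensor ![x, conn c L.unit ![]] = x
  quant_one : ∀ (Q : L.Quant) (b : C) (r : P.obj (op b)),
    quant Q b (𝟙_ C) (P.map (fst b (𝟙_ C)).op r) = r
  quant_prod : ∀ (Q : L.Quant) (b c d : C) (r : P.obj (op ((b ⊗ c) ⊗ d))),
    quant Q b (c ⊗ d) (P.map (α_ b c d).inv.op r) = quant Q b c (quant Q (b ⊗ c) d r)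
  EqPred_one : EqPred (𝟙_ C) = conn (𝟙_ C ⊗ 𝟙_ C) L.unit ![]
  EqPred_prod : ∀ c₁ c₂ : C, EqPred (c₁ ⊗ c₂) = conn ((c₁ ⊗ c₂) ⊗ (c₁ ⊗ c₂)) L.tensor
    ![P.map (lift (fst (c₁ ⊗ c₂) (c₁ ⊗ c₂) ≫ fst c₁ c₂)
        (snd (c₁ ⊗ c₂) (c₁ ⊗ c₂) ≫ fst c₁ c₂)).op (EqPred c₁),
      P.map (lift (fst (c₁ ⊗ c₂) (c₁ ⊗ c₂) ≫ snd c₁ c₂)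
        (snd (c₁ ⊗ c₂) (c₁ ⊗ c₂) ≫ snd c₁ c₂)).op (EqPred c₂)]

attribute [instance] PropCat.cat PropCat.cart

namespace PropCat

variable {L : Language.{u}}

/-- The fibre `P(c)`. -/
abbrev Fib (D : PropCat.{u, v, w, p} L) (c : D.C) : PartOrd.{p} := D.P.obj (op c)

/-- Reindexing `P(f) : P(d) → P(c)` along `f : c ⟶ d`. -/
abbrev re (D : PropCat.{u, v, w, p} L) {c d : D.C} (f : c ⟶ d) (r : D.Fib d) : D.Fib c :=
  D.P.map f.op r

/-- `r₁ ⊗ ⋯ ⊗ rₙ`, which is `e` when `n = 0`. -/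
def tensList (D : PropCat.{u, v, w, p} L) (c : D.C) : List (D.Fib c) → D.Fib c
  | [] => D.conn c L.unit ![]
  | r :: l => D.conn c L.tensor ![r, D.tensList c l]

/-- The product `⟦Γ⟧` of the objects interpreting the sorts of `Γ`, bracketed to the left and
starting from the terminal object. -/
def ctx (D : PropCat.{u, v, w, p} L) {S : Type s} (X : S → D.C) : List S → D.C
  | [] => 𝟙_ D.C
  | σ :: Γ => D.ctx X Γ ⊗ X σ

/-- The projection of `⟦Γ⟧` belonging to a variable of `Γ`. -/
def proj (D : PropCat.{u, v, w, p} L) {S : Type s} (X : S → D.C) :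
    ∀ {Γ : List S} {σ : S}, Var Γ σ → (D.ctx X Γ ⟶ X σ)
  | _, _, .zero (Γ := Γ) (σ := σ) => snd (D.ctx X Γ) (X σ)
  | _, _, .succ (Γ := Γ) (τ := τ) x => fst (D.ctx X Γ) (X τ) ≫ D.proj X x

/-- The morphism into `⟦Δ⟧` with given components. -/
def tuple (D : PropCat.{u, v, w, p} L) {S : Type s} (X : S → D.C) {Y : D.C} :
    ∀ Δ : List S, (∀ σ, Var Δ σ → (Y ⟶ X σ)) → (Y ⟶ D.ctx X Δ)
  | [], _ => toUnit Y
  | σ :: Δ, m => lift (D.tuple X Δ fun τ x => m τ x.succ) (m σ .zero)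

end PropCat

/-! ## Structures in prop-categories and soundness -/

/-- An `Sg`-structure in a prop-category. -/
structure Str {L : Language.{u}} (Sg : Signature.{s}) (D : PropCat.{u, v, w, p} L) where
  /-- interpretation of sorts -/
  sort : Sg.Srt → D.C
  /-- interpretation of function symbols -/
  func : ∀ f : Sg.Func, D.ctx sort (Sg.dom f) ⟶ sort (Sg.cod f)
  /-- interpretation of relation symbols -/
  rel : ∀ R : Sg.Rel, D.Fib (D.ctx sort (Sg.ar R))

namespace Str

variable {L : Language.{u}} {Sg : Signature.{s}} {D : PropCat.{u, v, w, p} L}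

/-- The interpretation of a context. -/
abbrev ctx (S : Str Sg D) (Γ : List Sg.Srt) : D.C := D.ctx S.sort Γ

/-- The interpretation of terms-in-context. -/
def term (S : Str Sg D) {Γ : List Sg.Srt} :
    ∀ {τ : Sg.Srt}, Term Sg Γ τ → (S.ctx Γ ⟶ S.sort τ)
  | _, .var x => D.proj S.sort x
  | _, .app f a => D.tuple S.sort (Sg.dom f) (fun σ x => S.term (a σ x)) ≫ S.func f

/-- The interpretation of formulas-in-context. -/
def form (S : Str Sg D) : ∀ {Γ : List Sg.Srt}, Formula L Sg Γ → D.Fib (S.ctx Γ)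
  | _, .rel R a => D.re (D.tuple S.sort (Sg.ar R) fun σ x => S.term (a σ x)) (S.rel R)
  | _, .eq (σ := σ) M N => D.re (lift (S.term M) (S.term N)) (D.EqPred (S.sort σ))
  | Γ, .conn c φ => D.conn (S.ctx Γ) c fun i => S.form (φ i)
  | Γ, .quant Q σ φ => D.quant Q (S.ctx Γ) (S.sort σ) (S.form φ)

/-- Satisfaction of an assertion. -/
def Sat (S : Str Sg D) : Assertion L Sg → Prop
  | .eqn M N => S.term M = S.term N
  | .seq (Γ := Γ) Φ ψ => D.tensList (S.ctx Γ) (Φ.map fun φ => S.form φ) ≤ S.form ψ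

/-- `S` is a `T`-model. -/
def IsModel (S : Str Sg D) (T : Theory L Sg) : Prop := ∀ a ∈ T, S.Sat a

end Str

/-- `D` is an object of `FA_𝓛`, i.e. `𝓛` is sound for structures in `D`: whenever `T'` is derivable
from `T` in `𝓛`, every `T`-model in `D` is a `T'`-model. -/
def Logic.Sound {L : Language.{u}} (𝓛 : Logic.{u, s} L) (D : PropCat.{u, v, w, p} L) : Prop :=
  ∀ (Sg : Signature.{s}) (T T' : Theory L Sg), T' ≤ 𝓛.cl Sg T →
    ∀ S : Str Sg D, S.IsModel T → S.IsModel T'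

/-! ## Morphisms of prop-categories -/

/-- Morphisms of `FA`. The components of the natural transformation `P ⇒ Q ∘ F` are given as monotone
maps, so that the two prop-categories may live in different universes. -/
structure Mor {L : Language.{u}} (A : PropCat.{u, v₁, w₁, p₁} L)
    (B : PropCat.{u, v₂, w₂, p₂} L) where
  /-- the functor between the base categories -/
  o : A.C ⥤ B.C
  [preserves : Limits.PreservesFiniteProducts o]
  /-- the components of the natural transformation -/
  p : ∀ c : A.C, A.Fib c →o B.Fib (o.obj c)
  natural : ∀ {c d : A.C} (f : c ⟶ d) (r : A.Fib d), p c (A.re f r) = B.re (o.map f) (p d r)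
  map_conn : ∀ (c : A.C) {n : ℕ} (k : L.Conn n) (r : Fin n → A.Fib c),
    p c (A.conn c k r) = B.conn (o.obj c) k fun i => p c (r i)
  map_quant : ∀ (Q : L.Quant) (b c : A.C) (r : A.Fib (b ⊗ c)),
    p b (A.quant Q b c r) =
      B.quant Q (o.obj b) (o.obj c) (B.re (inv (prodComparison o b c)) (p (b ⊗ c) r))
  map_EqPred : ∀ c : A.C, p (c ⊗ c) (A.EqPred c) = B.re (prodComparison o c c) (B.EqPred (o.obj c))

attribute [instance] Mor.preserves


namespace PropCat

variable {L : Language.{u}}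

theorem re_id (D : PropCat.{u, v, w, p} L) (c : D.C) (r : D.Fib c) : D.re (𝟙 c) r = r := by
  simp [re]

theorem re_comp (D : PropCat.{u, v, w, p} L) {b c d : D.C} (f : b ⟶ c) (g : c ⟶ d)
    (r : D.Fib d) : D.re (f ≫ g) r = D.re f (D.re g r) := by
  simp [re]

theorem re_mono (D : PropCat.{u, v, w, p} L) {c d : D.C} (f : c ⟶ d) {r r' : D.Fib d}
    (h : r ≤ r') : D.re f r ≤ D.re f r' :=
  (D.P.map f.op).hom.monotone h

end PropCat

namespace Mor

variable {L : Language.{u}}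

/-- Composition `K ∘ F` of morphisms. -/
def comp {A : PropCat.{u, v₁, w₁, p₁} L} {B : PropCat.{u, v₂, w₂, p₂} L}
    {E : PropCat.{u, v₃, w₃, p₃} L} (K : Mor B E) (F : Mor A B) : Mor A E where
  o := F.o ⋙ K.o
  preserves := Limits.comp_preservesFiniteProducts F.o K.o
  p c := (K.p (F.o.obj c)).comp (F.p c)
  natural f r := by
    change K.p _ (F.p _ _) = _
    rw [F.natural, K.natural]; rfl
  map_conn c n k r := by
    change K.p _ (F.p _ _) = _
    rw [F.map_conn, K.map_conn]; rfl
  map_quant Q b c r := by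
    have := Limits.comp_preservesFiniteProducts F.o K.o
    change K.p _ (F.p _ _) = E.quant Q _ _ (E.re _ (K.p _ (F.p _ _)))
    rw [F.map_quant, K.map_quant, K.natural, ← PropCat.re_comp]
    congr 2
    apply IsIso.eq_inv_of_hom_inv_id
    rw [prodComparison_comp, Category.assoc, IsIso.hom_inv_id_assoc,
      ← Functor.map_comp, IsIso.hom_inv_id]
    exact K.o.map_id _
  map_EqPred c := by
    change K.p _ (F.p _ _) = _
    rw [F.map_EqPred, K.natural, K.map_EqPred, ← PropCat.re_comp, prodComparison_comp]
    rfl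

/-- Subprop-morphisms: faithful on the base and an order embedding on each fibre. -/
structure IsSubprop {A : PropCat.{u, v₁, w₁, p₁} L} {B : PropCat.{u, v₂, w₂, p₂} L}
    (F : Mor A B) : Prop where
  faithful : F.o.Faithful
  embedding : ∀ (c : A.C) (r r' : A.Fib c), F.p c r ≤ F.p c r' ↔ r ≤ r'

end Mor

/-! ## Products of prop-categories -/

/-- Pointwise designated finite products on a product of categories. -/
instance piCartesian {I : Type u} {C : I → Type v} [∀ i, Category.{w} (C i)]
    [∀ i, CartesianMonoidalCategory (C i)] : CartesianMonoidalCategory (∀ i, C i) where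
  isTerminalTensorUnit := Limits.IsTerminal.ofUniqueHom (fun _ _ => toUnit _)
    fun _ _ => funext fun _ => toUnit_unique _ _
  fst X Y i := fst (X i) (Y i)
  snd X Y i := snd (X i) (Y i)
  fst_def X Y := funext fun i => (fst_def (X i) (Y i)).trans (by
    congr 2)
  snd_def X Y := funext fun i => (snd_def (X i) (Y i)).trans (by
    congr 2)
  tensorProductIsBinaryProduct X Y := Limits.BinaryFan.IsLimit.mk _
    (fun f g i => lift (f i) (g i))
    (fun f g => funext fun i => lift_fst (f i) (g i))
    (fun f g => funext fun i => lift_snd (f i) (g i))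
    (fun f g m hf hg => funext fun i =>
      CartesianMonoidalCategory.hom_ext _ _
        ((congrFun hf i).trans (lift_fst (f i) (g i)).symm)
        ((congrFun hg i).trans (lift_snd (f i) (g i)).symm))

namespace PropCat

variable {L : Language.{u}}

theorem pi_pair {I : Type*} {X : I → Type*} (x y : ∀ i, X i) (i : I) :
    (fun j => (![x, y] : Fin 2 → ∀ i, X i) j i) = ![x i, y i] := by
  funext j; fin_cases j <;> rfl

theorem pi_nil {I : Type*} {X : I → Type*} (i : I) :
    (fun j => (![] : Fin 0 → ∀ i, X i) j i) = ![] := by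
  funext j; exact j.elim0

/-- The product of a family of prop-categories indexed by a set, formed componentwise. -/
def pi {I : Type u} (D : I → PropCat.{u, max u v, max u w, max u p} L) :
    PropCat.{u, max u v, max u w, max u p} L where
  C := ∀ i, (D i).C
  P :=
    { obj := fun c => PartOrd.of (∀ i, (D i).Fib (c.unop i))
      map := fun f => PartOrd.ofHom
        { toFun := fun r i => (D i).re (f.unop i) (r i)
          monotone' := fun _ _ h i => (D i).re_mono (f.unop i) (h i) }
      map_id := fun c => by
        ext r i; exact (D i).re_id _ _
      map_comp := fun f g => by
        ext r i; exact (D i).re_comp _ _ _ }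
  conn c _ k r i := (D i).conn (c i) k fun j => r j i
  map_conn f _ k r := funext fun i => (D i).map_conn (f i) k fun j => r j i
  EqPred c i := (D i).EqPred (c i)
  quant Q b c r i := (D i).quant Q (b i) (c i) (r i)
  quant_natural Q _ _ f c r := funext fun i => (D i).quant_natural Q (f i) (c i) (r i)
  tensor_assoc c x y z := funext fun i => by
    simp only [pi_pair]
    exact (D i).tensor_assoc (c i) (x i) (y i) (z i)
  unit_tensor c x := funext fun i => by
    simp only [pi_pair, pi_nil]
    exact (D i).unit_tensor (c i) (x i)
  tensor_unit c x := funext fun i => by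
    simp only [pi_pair, pi_nil]
    exact (D i).tensor_unit (c i) (x i)
  quant_one Q b r := funext fun i => (D i).quant_one Q (b i) (r i)
  quant_prod Q b c d r := funext fun i => (D i).quant_prod Q (b i) (c i) (d i) (r i)
  EqPred_one := funext fun i => by
    simp only [pi_nil]
    exact (D i).EqPred_one
  EqPred_prod c₁ c₂ := funext fun i => by
    simp only [pi_pair]
    exact (D i).EqPred_prod (c₁ i) (c₂ i)

end PropCat

/-- A functor whose product and terminal comparison morphisms are invertible preserves finite
products. -/
theorem preservesFiniteProducts_of_comparison {C : Type v₁} [Category.{w₁} C]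
    [CartesianMonoidalCategory C] {D : Type v₂} [Category.{w₂} D] [CartesianMonoidalCategory D]
    (F : C ⥤ D) (h₀ : IsIso (terminalComparison F)) (h : ∀ b c : C, IsIso (prodComparison F b c)) :
    Limits.PreservesFiniteProducts F := by
  have := preservesLimitsOfShape_discrete_walkingPair_of_isIso_prodComparison F
  have := preservesLimit_empty_of_isIso_terminalComparison F
  have := Limits.preservesLimitsOfShape_pempty_of_preservesTerminal F
  exact Limits.PreservesFiniteProducts.of_preserves_binary_and_terminal F

theorem inv_pi {I : Type u} {C : I → Type v} [∀ i, Category.{w} (C i)] {X Y : ∀ i, C i}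
    (f : X ⟶ Y) [IsIso f] (i : I) [IsIso (f i)] : inv f i = inv (f i) := by
  apply IsIso.eq_inv_of_hom_inv_id
  exact congrFun (IsIso.hom_inv_id f) i

theorem piFunctor_preserves {A : Type v₁} [Category.{w₁} A] [CartesianMonoidalCategory A]
    {I : Type u} {C : I → Type v} [∀ i, Category.{w} (C i)] [∀ i, CartesianMonoidalCategory (C i)]
    (F : ∀ i, A ⥤ C i) [∀ i, Limits.PreservesFiniteProducts (F i)] :
    Limits.PreservesFiniteProducts (Functor.pi' F) := by
  apply preservesFiniteProducts_of_comparison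
  · rw [isIso_pi_iff]
    intro i
    exact (inferInstance : IsIso (terminalComparison (F i)))
  · intro b c
    rw [isIso_pi_iff]
    intro i
    exact (inferInstance : IsIso (prodComparison (F i) b c))

/-- The morphism `⟨Fᵢ⟩` into a product of prop-categories with given components. -/
def Mor.pi {L : Language.{u}} {A : PropCat.{u, v₁, w₁, p₁} L} {I : Type u}
    {D : I → PropCat.{u, max u v, max u w, max u p} L} (F : ∀ i, Mor A (D i)) :
    Mor A (PropCat.pi D) where
  o := Functor.pi' fun i => (F i).o
  preserves := piFunctor_preserves fun i => (F i).o
  p c :=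
    { toFun := fun r i => (F i).p c r
      monotone' := fun _ _ h i => (F i).p c |>.monotone h }
  natural f r := funext fun i => (F i).natural f r
  map_conn c _ k r := funext fun i => (F i).map_conn c k r
  map_quant Q b c r := funext fun i => by
    have := piFunctor_preserves fun i => (F i).o
    refine ((F i).map_quant Q b c r).trans ?_
    have hi : IsIso ((prodComparison (Functor.pi' fun i => (F i).o) b c) i) :=
      (inferInstance : IsIso (prodComparison (F i).o b c))
    have h : inv (prodComparison (F i).o b c) =
        inv (prodComparison (Functor.pi' fun i => (F i).o) b c) i :=
      (inv_pi (prodComparison (Functor.pi' fun i => (F i).o) b c) i).symm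
    rw [h]
    rfl
  map_EqPred c := funext fun i => (F i).map_EqPred c

/-! ## Auxiliary constructions on contexts, substitutions and formulas -/

section Contexts

variable {L : Language.{u}} {Sg : Signature.{s}}

/-- The variables of `Γ` inside `Γ, Δ`. -/
def Var.right {S : Type s} {Γ : List S} {σ : S} : ∀ Δ : List S, Var Γ σ → Var (Δ ++ Γ) σ
  | [], x => x
  | _ :: Δ, x => (Var.right Δ x).succ

/-- The variables of `Δ` inside `Γ, Δ`. -/
def Var.left {S : Type s} (Γ : List S) : ∀ {Δ : List S} {σ : S}, Var Δ σ → Var (Δ ++ Γ) σ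
  | _, _, .zero => .zero
  | _, _, .succ x => (Var.left Γ x).succ

theorem Var.left_or_right {S : Type s} {Γ : List S} {σ : S} :
    ∀ {Δ : List S} (x : Var (Δ ++ Γ) σ),
      (∃ y : Var Δ σ, x = y.left Γ) ∨ ∃ y : Var Γ σ, x = y.right Δ
  | [], x => .inr ⟨x, rfl⟩
  | _ :: _, .zero => .inl ⟨.zero, rfl⟩
  | _ :: Δ, .succ x => by
    rcases Var.left_or_right (Δ := Δ) x with ⟨y, rfl⟩ | ⟨y, rfl⟩
    · exact .inl ⟨y.succ, rfl⟩
    · exact .inr ⟨y, rfl⟩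

/-- The projection `Γ, Δ ⟶ Γ`. -/
def Subst.fst (Γ Δ : List Sg.Srt) : Subst Sg (Δ ++ Γ) Γ := fun _ x => .var (x.right Δ)

/-- The projection `Γ, Δ ⟶ Δ`. -/
def Subst.snd (Γ Δ : List Sg.Srt) : Subst Sg (Δ ++ Γ) Δ := fun _ x => .var (x.left Γ)

/-- The empty list of terms. -/
def Subst.empty (Γ : List Sg.Srt) : Subst Sg Γ [] := fun _ x => nomatch x

theorem Subst.eq_empty {Γ : List Sg.Srt} (γ : Subst Sg Γ []) : γ = Subst.empty Γ :=
  funext fun _ => funext fun x => nomatch x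

/-- Concatenation of lists of terms. -/
def Subst.pair {Θ Γ : List Sg.Srt} (γ : Subst Sg Θ Γ) :
    ∀ {Δ : List Sg.Srt}, Subst Sg Θ Δ → Subst Sg Θ (Δ ++ Γ)
  | [], _ => γ
  | _ :: _, δ => fun
    | _, .zero => δ _ .zero
    | _, .succ x => Subst.pair γ (fun _ y => δ _ y.succ) _ x

theorem Subst.pair_right {Θ Γ : List Sg.Srt} (γ : Subst Sg Θ Γ) {σ : Sg.Srt} (x : Var Γ σ) :
    ∀ {Δ : List Sg.Srt} (δ : Subst Sg Θ Δ), Subst.pair γ δ σ (x.right Δ) = γ σ x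
  | [], _ => rfl
  | _ :: _, δ => Subst.pair_right γ x fun _ y => δ _ y.succ

theorem Subst.pair_left {Θ Γ : List Sg.Srt} (γ : Subst Sg Θ Γ) {σ : Sg.Srt} :
    ∀ {Δ : List Sg.Srt} (δ : Subst Sg Θ Δ) (x : Var Δ σ),
      Subst.pair γ δ σ (x.left Γ) = δ σ x
  | _ :: _, _, .zero => rfl
  | _ :: _, δ, .succ x => Subst.pair_left γ (fun _ y => δ _ y.succ) x

/-- Iterated `Subst.lift`. -/
def Subst.liftN {Γ Γ' : List Sg.Srt} (γ : Subst Sg Γ Γ') :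
    ∀ Δ : List Sg.Srt, Subst Sg (Δ ++ Γ) (Δ ++ Γ')
  | [] => γ
  | σ :: Δ => (γ.liftN Δ).lift σ

theorem Subst.liftN_right {Γ Γ' : List Sg.Srt} (γ : Subst Sg Γ Γ') {σ : Sg.Srt}
    (x : Var Γ' σ) : ∀ Δ : List Sg.Srt,
      γ.liftN Δ σ (x.right Δ) = (γ σ x).subst (Subst.fst Γ Δ)
  | [] => (Term.subst_id _).symm
  | τ :: Δ => by
    change (γ.liftN Δ σ (x.right Δ)).wk τ = _
    rw [Subst.liftN_right γ x Δ, Term.wk, Term.ren_subst]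
    rfl

theorem Subst.liftN_left {Γ Γ' : List Sg.Srt} (γ : Subst Sg Γ Γ') {σ : Sg.Srt} :
    ∀ {Δ : List Sg.Srt} (x : Var Δ σ), γ.liftN Δ σ (x.left Γ') = .var (x.left Γ)
  | _ :: _, .zero => rfl
  | τ :: Δ, .succ x => by
    change (γ.liftN Δ σ (x.left Γ')).wk τ = _
    rw [Subst.liftN_left γ x]
    rfl

/-- The change-of-bracketing substitution. -/
def Subst.assoc (Γ Δ : List Sg.Srt) :
    ∀ Θ : List Sg.Srt, Subst Sg ((Θ ++ Δ) ++ Γ) (Θ ++ (Δ ++ Γ))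
  | [] => Subst.id _
  | σ :: Θ => (Subst.assoc Γ Δ Θ).lift σ

theorem Subst.assoc_right_right (Γ Δ : List Sg.Srt) {σ : Sg.Srt} (x : Var Γ σ) :
    ∀ Θ : List Sg.Srt,
      Subst.assoc (Sg := Sg) Γ Δ Θ σ ((x.right Δ).right Θ) = .var (x.right (Θ ++ Δ))
  | [] => rfl
  | τ :: Θ => by
    change (Subst.assoc Γ Δ Θ σ ((x.right Δ).right Θ)).wk τ = _
    rw [Subst.assoc_right_right Γ Δ x Θ]
    rfl

theorem Subst.assoc_left_right (Γ Δ : List Sg.Srt) {σ : Sg.Srt} (x : Var Δ σ) :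
    ∀ Θ : List Sg.Srt,
      Subst.assoc (Sg := Sg) Γ Δ Θ σ ((x.left Γ).right Θ) = .var ((x.right Θ).left Γ)
  | [] => rfl
  | τ :: Θ => by
    change (Subst.assoc Γ Δ Θ σ ((x.left Γ).right Θ)).wk τ = _
    rw [Subst.assoc_left_right Γ Δ x Θ]
    rfl

theorem Subst.assoc_left (Γ Δ : List Sg.Srt) {σ : Sg.Srt} :
    ∀ {Θ : List Sg.Srt} (x : Var Θ σ),
      Subst.assoc (Sg := Sg) Γ Δ Θ σ (x.left (Δ ++ Γ)) = .var ((x.left Δ).left Γ)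
  | _ :: _, .zero => rfl
  | τ :: Θ, .succ x => by
    change (Subst.assoc Γ Δ Θ σ (x.left (Δ ++ Γ))).wk τ = _
    rw [Subst.assoc_left Γ Δ x]
    rfl

/-- Quantification `Q_{y₁} ⋯ Q_{yₘ} φ` over all the variables of a context `Δ = y₁, …, yₘ`. -/
def Formula.quantAll (Q : L.Quant) {Γ : List Sg.Srt} :
    ∀ Δ : List Sg.Srt, Formula L Sg (Δ ++ Γ) → Formula L Sg Γ
  | [], φ => φ
  | σ :: Δ, φ => Formula.quantAll Q Δ (.quant Q σ φ)

theorem Formula.quantAll_subst (Q : L.Quant) {Γ Γ' : List Sg.Srt} (γ : Subst Sg Γ Γ') :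
    ∀ (Δ : List Sg.Srt) (φ : Formula L Sg (Δ ++ Γ')),
      (φ.quantAll Q Δ).subst γ = (φ.subst (γ.liftN Δ)).quantAll Q Δ
  | [], _ => rfl
  | σ :: Δ, φ => Formula.quantAll_subst Q γ Δ (.quant Q σ φ)

theorem Formula.quantAll_assoc (Q : L.Quant) (Γ Δ : List Sg.Srt) :
    ∀ (Θ : List Sg.Srt) (φ : Formula L Sg (Θ ++ (Δ ++ Γ))),
      (φ.subst (Subst.assoc Γ Δ Θ)).quantAll Q (Θ ++ Δ) = (φ.quantAll Q Θ).quantAll Q Δ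
  | [], φ => by
    change (φ.subst (Subst.id _)).quantAll Q Δ = _
    rw [Formula.subst_id]; rfl
  | σ :: Θ, φ => Formula.quantAll_assoc Q Γ Δ Θ (.quant Q σ φ)

/-- The formula `M₁ = N₁ ⊗ ⋯ ⊗ Mₙ = Nₙ` (bracketed to the left and starting with `e`) for two
lists of terms `M` and `N`. -/
def Formula.eqAll {Γ : List Sg.Srt} :
    ∀ Δ : List Sg.Srt, Subst Sg Γ Δ → Subst Sg Γ Δ → Formula L Sg Γ
  | [], _, _ => Formula.one Γ
  | _ :: Δ, γ, δ =>
    (Formula.eqAll Δ (fun _ x => γ _ x.succ) (fun _ x => δ _ x.succ)).tens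
      (.eq (γ _ .zero) (δ _ .zero))

theorem Formula.eqAll_subst {Γ Θ : List Sg.Srt} (θ : Subst Sg Θ Γ) :
    ∀ (Δ : List Sg.Srt) (γ δ : Subst Sg Γ Δ),
      (Formula.eqAll (L := L) Δ γ δ).subst θ = Formula.eqAll Δ (θ.comp γ) (θ.comp δ)
  | [], _, _ => Formula.subst_one θ
  | σ :: Δ, γ, δ => by
    refine (Formula.subst_tens θ _ _).trans ?_
    exact congrArg (fun φ => φ.tens (.eq ((γ σ .zero).subst θ) ((δ σ .zero).subst θ)))
      (Formula.eqAll_subst θ Δ (fun _ x => γ _ x.succ) fun _ x => δ _ x.succ)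

end Contexts

/-! ## The classifying prop-category of a theory of the minimal logic -/

section Classifying

variable {L : Language.{u}} {Sg : Signature.{s}} {T : Theory L Sg}

/-- Provable equality of lists of terms. -/
def substSetoid (hT : LmClosed T) (Γ Δ : List Sg.Srt) : Setoid (Subst Sg Γ Δ) where
  r γ γ' := ∀ (σ : Sg.Srt) (x : Var Δ σ), Assertion.eqn (γ σ x) (γ' σ x) ∈ T
  iseqv :=
    { refl := fun γ σ x => hT.refl (γ σ x)
      symm := fun {_ _} h σ x => hT.symm (h σ x)
      trans := fun {_ _ _} h h' σ x => hT.trans (h σ x) (h' σ x) }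

/-- Interderivability of formulas. -/
def formSetoid (hT : LmClosed T) (Γ : List Sg.Srt) : Setoid (Formula L Sg Γ) where
  r φ ψ := Assertion.seq [φ] ψ ∈ T ∧ Assertion.seq [ψ] φ ∈ T
  iseqv :=
    { refl := fun φ => ⟨hT.ax φ, hT.ax φ⟩
      symm := fun {_ _} h => ⟨h.2, h.1⟩
      trans := fun {_ _ _} h h' => ⟨hT.cut h.1 h'.1, hT.cut h'.2 h.2⟩ }

/-- The objects of the base of the classifying prop-category: contexts. -/
def ClsObj (_ : LmClosed T) : Type s := List Sg.Srt

/-- Morphisms `Γ ⟶ Δ`: lists of terms in context `Γ` matching `Δ`, up to provable equality. -/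
def ClsHom (hT : LmClosed T) (Γ Δ : List Sg.Srt) : Type s := Quotient (substSetoid hT Γ Δ)

/-- The morphism given by a list of terms. -/
def ClsHom.mk (hT : LmClosed T) {Γ Δ : List Sg.Srt} (γ : Subst Sg Γ Δ) : ClsHom hT Γ Δ :=
  Quotient.mk (substSetoid hT Γ Δ) γ

/-- Composition is substitution. -/
instance clsCategory (hT : LmClosed T) : Category.{s} (ClsObj hT) where
  Hom Γ Δ := ClsHom hT Γ Δ
  id Γ := ClsHom.mk hT (Subst.id Γ)
  comp {Γ Δ Θ} f g := Quotient.map₂ (sa := substSetoid hT Γ Δ) (sb := substSetoid hT Δ Θ)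
    (sc := substSetoid hT Γ Θ) Subst.comp
    (fun γ γ' (h : ∀ σ x, Assertion.eqn (γ σ x) (γ' σ x) ∈ T) δ δ'
      (h' : ∀ σ x, Assertion.eqn (δ σ x) (δ' σ x) ∈ T) σ x => hT.subst h (h' σ x)) f g
  id_comp := by
    rintro Γ Δ ⟨γ⟩
    exact congrArg (ClsHom.mk hT) (funext fun σ => funext fun x => Term.subst_id _)
  comp_id := by
    rintro Γ Δ ⟨γ⟩
    rfl
  assoc := by
    rintro Γ Δ Θ Ξ ⟨γ⟩ ⟨δ⟩ ⟨θ⟩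
    exact congrArg (ClsHom.mk hT)
      (funext fun σ => funext fun x => (Term.subst_subst γ δ (θ σ x)).symm)

theorem Subst.pair_congr {Θ Γ Δ : List Sg.Srt} {γ γ' : Subst Sg Θ Γ}
    {δ δ' : Subst Sg Θ Δ} (h : ∀ σ x, Assertion.eqn (γ σ x) (γ' σ x) ∈ T)
    (h' : ∀ σ x, Assertion.eqn (δ σ x) (δ' σ x) ∈ T) (σ : Sg.Srt) (x : Var (Δ ++ Γ) σ) :
    Assertion.eqn (γ.pair δ σ x) (γ'.pair δ' σ x) ∈ T := by
  rcases Var.left_or_right x with ⟨y, rfl⟩ | ⟨y, rfl⟩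
  · rw [Subst.pair_left, Subst.pair_left]; exact h' σ y
  · rw [Subst.pair_right, Subst.pair_right]; exact h σ y

theorem Subst.pair_unique {Θ Γ Δ : List Sg.Srt} {γ : Subst Sg Θ Γ} {δ : Subst Sg Θ Δ}
    {ε : Subst Sg Θ (Δ ++ Γ)}
    (h : ∀ σ x, Assertion.eqn (ε σ (x.right Δ)) (γ σ x) ∈ T)
    (h' : ∀ σ x, Assertion.eqn (ε σ (x.left Γ)) (δ σ x) ∈ T) (σ : Sg.Srt) (x : Var (Δ ++ Γ) σ) :
    Assertion.eqn (ε σ x) (γ.pair δ σ x) ∈ T := by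
  rcases Var.left_or_right x with ⟨y, rfl⟩ | ⟨y, rfl⟩
  · rw [Subst.pair_left]; exact h' σ y
  · rw [Subst.pair_right]; exact h σ y

/-- Concatenation of (classes of) lists of terms. -/
def ClsHom.pair {hT : LmClosed T} {Θ Γ Δ : List Sg.Srt} (f : ClsHom hT Θ Γ)
    (g : ClsHom hT Θ Δ) : ClsHom hT Θ (Δ ++ Γ) :=
  Quotient.map₂ (sa := substSetoid hT Θ Γ) (sb := substSetoid hT Θ Δ)
    (sc := substSetoid hT Θ (Δ ++ Γ)) (fun γ δ => Subst.pair γ δ)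
    (fun _ _ h _ _ h' => Subst.pair_congr h h') f g

/-- The empty context is terminal. -/
def clsTerminal (hT : LmClosed T) : Limits.LimitCone (Functor.empty.{0} (ClsObj hT)) where
  cone := Limits.asEmptyCone (C := ClsObj hT) ([] : List Sg.Srt)
  isLimit := Limits.IsTerminal.ofUniqueHom
    (fun Γ => (ClsHom.mk hT (Subst.empty Γ) : ClsHom hT Γ []))
    (fun Γ f => Quotient.inductionOn (s := substSetoid hT Γ []) f
      fun γ => congrArg (ClsHom.mk hT) (Subst.eq_empty γ))

/-- The product of `Γ` and `Δ` is the context `Γ, Δ`. -/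
def clsProd (hT : LmClosed T) (Γ Δ : ClsObj hT) : Limits.LimitCone (Limits.pair Γ Δ) where
  cone := Limits.BinaryFan.mk (P := (List.append Δ Γ : ClsObj hT))
    (ClsHom.mk hT (Subst.fst Γ Δ)) (ClsHom.mk hT (Subst.snd Γ Δ))
  isLimit := Limits.BinaryFan.IsLimit.mk _ (fun f g => ClsHom.pair f g)
    (by
      rintro Θ ⟨γ⟩ ⟨δ⟩
      exact congrArg (ClsHom.mk hT)
        (funext fun σ => funext fun x => Subst.pair_right γ x δ))
    (by
      rintro Θ ⟨γ⟩ ⟨δ⟩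
      exact congrArg (ClsHom.mk hT)
        (funext fun σ => funext fun x => Subst.pair_left γ δ x))
    (by
      rintro Θ ⟨γ⟩ ⟨δ⟩ ⟨ε⟩ h h'
      have h₁ := Quotient.exact h
      have h₂ := Quotient.exact h'
      exact Quotient.sound (s := substSetoid hT Θ (List.append Δ Γ))
        (Subst.pair_unique h₁ h₂))

instance clsCartesian (hT : LmClosed T) : CartesianMonoidalCategory (ClsObj hT) :=
  CartesianMonoidalCategory.ofChosenFiniteProducts (clsTerminal hT) (clsProd hT)

/-- The fibre over `Γ`: formulas in context `Γ` up to interderivability. -/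
def ClsFib (hT : LmClosed T) (Γ : List Sg.Srt) : Type (max u s) := Quotient (formSetoid hT Γ)

/-- The class of a formula. -/
def ClsFib.mk (hT : LmClosed T) {Γ : List Sg.Srt} (φ : Formula L Sg Γ) : ClsFib hT Γ :=
  Quotient.mk (formSetoid hT Γ) φ

instance clsFibOrder (hT : LmClosed T) (Γ : List Sg.Srt) : PartialOrder (ClsFib hT Γ) where
  le := Quotient.lift₂ (s₁ := formSetoid hT Γ) (s₂ := formSetoid hT Γ)
    (fun φ ψ => Assertion.seq [φ] ψ ∈ T)
    (fun _ _ _ _ h h' => propext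
      ⟨fun k => hT.cut h.2 (hT.cut k h'.1), fun k => hT.cut h.1 (hT.cut k h'.2)⟩)
  le_refl := by rintro ⟨φ⟩; exact hT.ax φ
  le_trans := by rintro ⟨φ⟩ ⟨ψ⟩ ⟨θ⟩ h h'; exact hT.cut h h'
  le_antisymm := by
    rintro ⟨φ⟩ ⟨ψ⟩ h h'
    exact Quotient.sound (s := formSetoid hT Γ) ⟨h, h'⟩

/-- Reindexing is substitution. -/
def ClsFib.re {hT : LmClosed T} {Γ Δ : List Sg.Srt} (f : ClsHom hT Γ Δ) :
    ClsFib hT Δ → ClsFib hT Γ :=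
  Quotient.map₂ (sa := substSetoid hT Γ Δ) (sb := formSetoid hT Δ) (sc := formSetoid hT Γ)
    (fun γ φ => φ.subst γ)
    (fun γ γ' (h : ∀ σ x, Assertion.eqn (γ σ x) (γ' σ x) ∈ T) φ ψ
      (h' : Assertion.seq [φ] ψ ∈ T ∧ Assertion.seq [ψ] φ ∈ T) =>
        ⟨hT.sub h h'.1, hT.sub (fun σ x => hT.symm (h σ x)) h'.2⟩) f

/-- The connectives on a fibre. -/
noncomputable def ClsFib.conn {hT : LmClosed T} {Γ : List Sg.Srt} {n : ℕ} (k : L.Conn n)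
    (r : Fin n → ClsFib hT Γ) : ClsFib hT Γ :=
  ClsFib.mk hT (.conn k fun i => Quotient.out (r i))

theorem ClsFib.conn_mk (hT : LmClosed T) {Γ : List Sg.Srt} {n : ℕ} (k : L.Conn n)
    (φ : Fin n → Formula L Sg Γ) :
    ClsFib.conn k (fun i => ClsFib.mk hT (φ i)) = ClsFib.mk hT (.conn k φ) := by
  have h := fun i => Quotient.mk_out (s := formSetoid hT Γ) (φ i)
  exact Quotient.sound (s := formSetoid hT Γ)
    ⟨hT.conn_cong k (fun i => (h i).1) fun i => (h i).2,
      hT.conn_cong k (fun i => (h i).2) fun i => (h i).1⟩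

theorem ClsFib.exists_rep {hT : LmClosed T} {Γ : List Sg.Srt} {ι : Type} (r : ι → ClsFib hT Γ) :
    ∃ φ : ι → Formula L Sg Γ, r = fun i => ClsFib.mk hT (φ i) :=
  ⟨fun i => Quotient.out (r i), funext fun i => (Quotient.out_eq (r i)).symm⟩

theorem ClsFib.tens_mk (hT : LmClosed T) {Γ : List Sg.Srt} (φ ψ : Formula L Sg Γ) :
    ClsFib.conn L.tensor ![ClsFib.mk hT φ, ClsFib.mk hT ψ] = ClsFib.mk hT (φ.tens ψ) := by
  rw [Formula.tens, ← ClsFib.conn_mk]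
  congr 1; funext i; fin_cases i <;> rfl

theorem ClsFib.one_mk (hT : LmClosed T) (Γ : List Sg.Srt) :
    ClsFib.conn L.unit ![] = ClsFib.mk hT (Formula.one (L := L) Γ) := by
  rw [Formula.one, ← ClsFib.conn_mk]
  congr 1; funext i; exact i.elim0

theorem ClsFib.tens_assoc (hT : LmClosed T) {Γ : List Sg.Srt} (α β γ : Formula L Sg Γ) :
    ClsFib.mk hT ((α.tens β).tens γ) = ClsFib.mk hT (α.tens (β.tens γ)) := by
  apply Quotient.sound (s := formSetoid hT Γ)
  constructor
  · refine (hT.tensor_ref [] [] _ _ _).1 ((hT.tensor_ref [] [γ] _ _ _).1 ?_)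
    exact (hT.tensor_ref [α] [] _ _ _).2 ((hT.tensor_ref [] [] _ _ _).2 (hT.ax _))
  · refine (hT.tensor_ref [] [] _ _ _).1 ((hT.tensor_ref [α] [] _ _ _).1 ?_)
    exact (hT.tensor_ref [] [γ] _ _ _).2 ((hT.tensor_ref [] [] _ _ _).2 (hT.ax _))

theorem ClsFib.one_tens (hT : LmClosed T) {Γ : List Sg.Srt} (α : Formula L Sg Γ) :
    ClsFib.mk hT ((Formula.one Γ).tens α) = ClsFib.mk hT α := by
  apply Quotient.sound (s := formSetoid hT Γ)
  constructor
  · exact (hT.tensor_ref [] [] _ _ _).1 ((hT.unit_ref [] [α] _).2 (hT.ax _))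
  · exact (hT.unit_ref [] [α] _).1 ((hT.tensor_ref [] [] _ _ _).2 (hT.ax _))

theorem ClsFib.tens_one (hT : LmClosed T) {Γ : List Sg.Srt} (α : Formula L Sg Γ) :
    ClsFib.mk hT (α.tens (Formula.one Γ)) = ClsFib.mk hT α := by
  apply Quotient.sound (s := formSetoid hT Γ)
  constructor
  · exact (hT.tensor_ref [] [] _ _ _).1 ((hT.unit_ref [α] [] _).2 (hT.ax _))
  · exact (hT.unit_ref [α] [] _).1 ((hT.tensor_ref [] [] _ _ _).2 (hT.ax _))

/-- Quantification over a context. -/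
def ClsFib.quant {hT : LmClosed T} (Q : L.Quant) (Γ Δ : List Sg.Srt) :
    ClsFib hT (Δ ++ Γ) → ClsFib hT Γ :=
  Quotient.map (sa := formSetoid hT (Δ ++ Γ)) (sb := formSetoid hT Γ)
    (fun φ => φ.quantAll Q Δ)
    (by
      induction Δ with
      | nil => exact fun _ _ h => h
      | cons σ Δ ih =>
        exact fun _ _ h => ih ⟨hT.quant_con Q σ h.1 h.2, hT.quant_con Q σ h.2 h.1⟩)

theorem ClsFib.eqAll_append (hT : LmClosed T) {Θ Γ : List Sg.Srt} :
    ∀ (Δ : List Sg.Srt) (γ δ : Subst Sg Θ (Δ ++ Γ)),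
      ClsFib.mk hT (Formula.eqAll (L := L) (Δ ++ Γ) γ δ) =
        ClsFib.mk hT ((Formula.eqAll Γ (fun _ x => γ _ (x.right Δ)) fun _ x => δ _ (x.right Δ)).tens
          (Formula.eqAll Δ (fun _ x => γ _ (x.left Γ)) fun _ x => δ _ (x.left Γ)))
  | [], γ, δ => (ClsFib.tens_one hT _).symm
  | σ :: Δ, γ, δ => by
    have ih := ClsFib.eqAll_append hT Δ (fun _ x => γ _ x.succ) fun _ x => δ _ x.succ
    change ClsFib.mk hT (Formula.tens (Formula.eqAll (Δ ++ Γ) _ _) _) = _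
    refine (ClsFib.tens_mk hT _ _).symm.trans ?_
    refine (congrArg (fun z => ClsFib.conn L.tensor ![z, _]) ih).trans ?_
    exact (ClsFib.tens_mk hT _ _).trans (ClsFib.tens_assoc hT _ _ _)


theorem ClsFib.ind {hT : LmClosed T} {Γ : List Sg.Srt} {p : ClsFib hT Γ → Prop}
    (h : ∀ φ : Formula L Sg Γ, p (ClsFib.mk hT φ)) (r : ClsFib hT Γ) : p r :=
  Quotient.inductionOn (s := formSetoid hT Γ) r h

theorem ClsHom.ind {hT : LmClosed T} {Γ Δ : List Sg.Srt} {p : ClsHom hT Γ Δ → Prop}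
    (h : ∀ γ : Subst Sg Γ Δ, p (ClsHom.mk hT γ)) (f : ClsHom hT Γ Δ) : p f :=
  Quotient.inductionOn (s := substSetoid hT Γ Δ) f h

theorem ClsFib.re_mono {hT : LmClosed T} {Γ Δ : List Sg.Srt} (f : ClsHom hT Γ Δ) :
    Monotone (ClsFib.re f) := by
  induction f using ClsHom.ind with | _ γ
  intro r r' h
  induction r using ClsFib.ind with | _ φ
  induction r' using ClsFib.ind with | _ ψ
  exact hT.sub (fun σ x => hT.refl (γ σ x)) (Φ := [φ]) h

theorem ClsFib.re_conn {hT : LmClosed T} {Γ Δ : List Sg.Srt} (f : ClsHom hT Γ Δ) {n : ℕ}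
    (k : L.Conn n) (r : Fin n → ClsFib hT Δ) :
    ClsFib.re f (ClsFib.conn k r) = ClsFib.conn k fun i => ClsFib.re f (r i) := by
  induction f using ClsHom.ind with | _ γ
  obtain ⟨φ, rfl⟩ := ClsFib.exists_rep r
  rw [ClsFib.conn_mk]
  exact (ClsFib.conn_mk hT k fun i => (φ i).subst γ).symm

theorem ClsFib.conn_assoc {hT : LmClosed T} {Γ : List Sg.Srt} (x y z : ClsFib hT Γ) :
    ClsFib.conn L.tensor ![ClsFib.conn L.tensor ![x, y], z] =
      ClsFib.conn L.tensor ![x, ClsFib.conn L.tensor ![y, z]] := by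
  induction x using ClsFib.ind with | _ α
  induction y using ClsFib.ind with | _ β
  induction z using ClsFib.ind with | _ γ
  simp only [ClsFib.tens_mk]
  exact ClsFib.tens_assoc hT α β γ

theorem ClsFib.unit_conn {hT : LmClosed T} {Γ : List Sg.Srt} (x : ClsFib hT Γ) :
    ClsFib.conn L.tensor ![ClsFib.conn L.unit ![], x] = x := by
  induction x using ClsFib.ind with | _ α
  rw [ClsFib.one_mk, ClsFib.tens_mk]
  exact ClsFib.one_tens hT α

theorem ClsFib.conn_unit {hT : LmClosed T} {Γ : List Sg.Srt} (x : ClsFib hT Γ) :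
    ClsFib.conn L.tensor ![x, ClsFib.conn L.unit ![]] = x := by
  induction x using ClsFib.ind with | _ α
  rw [ClsFib.one_mk, ClsFib.tens_mk]
  exact ClsFib.tens_one hT α

theorem ClsFib.re_id {hT : LmClosed T} {Γ : List Sg.Srt} (r : ClsFib hT Γ) :
    ClsFib.re (ClsHom.mk hT (Subst.id Γ)) r = r := by
  induction r using ClsFib.ind with | _ φ
  exact congrArg (ClsFib.mk hT) φ.subst_id

theorem ClsFib.re_comp {hT : LmClosed T} {Γ Δ Θ : List Sg.Srt} (γ : Subst Sg Γ Δ)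
    (δ : Subst Sg Δ Θ) (r : ClsFib hT Θ) : ClsFib.re (ClsHom.mk hT (γ.comp δ)) r =
      ClsFib.re (ClsHom.mk hT γ) (ClsFib.re (ClsHom.mk hT δ) r) := by
  induction r using ClsFib.ind with | _ φ
  exact congrArg (ClsFib.mk hT) (φ.subst_subst γ δ).symm

theorem ClsFib.quant_nil {hT : LmClosed T} (Q : L.Quant) {Γ : List Sg.Srt} (r : ClsFib hT Γ) :
    ClsFib.quant Q Γ [] r = r := by
  induction r using ClsFib.ind with | _ φ
  rfl

theorem ClsFib.quant_re {hT : LmClosed T} (Q : L.Quant) {Γ Γ' : List Sg.Srt} (γ : Subst Sg Γ' Γ)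
    (Δ : List Sg.Srt) (r : ClsFib hT (Δ ++ Γ)) :
    ClsFib.quant Q Γ' Δ (ClsFib.re (ClsHom.mk hT (γ.liftN Δ)) r) =
      ClsFib.re (ClsHom.mk hT γ) (ClsFib.quant Q Γ Δ r) := by
  induction r using ClsFib.ind with | _ φ
  exact congrArg (ClsFib.mk hT) (Formula.quantAll_subst Q γ Δ φ).symm

theorem ClsFib.quant_assoc {hT : LmClosed T} (Q : L.Quant) (Γ Δ Θ : List Sg.Srt)
    (r : ClsFib hT (Θ ++ (Δ ++ Γ))) :
    ClsFib.quant Q Γ (Θ ++ Δ) (ClsFib.re (ClsHom.mk hT (Subst.assoc Γ Δ Θ)) r) =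
      ClsFib.quant Q Γ Δ (ClsFib.quant Q (Δ ++ Γ) Θ r) := by
  induction r using ClsFib.ind with | _ φ
  exact congrArg (ClsFib.mk hT) (Formula.quantAll_assoc Q Γ Δ Θ φ)

/-- The fibre over `Γ`, as a poset. -/
abbrev clsPoset (hT : LmClosed T) (Γ : List Sg.Srt) : PartOrd.{max u s} :=
  PartOrd.of (ClsFib hT Γ)

/-- Reindexing, as a morphism of posets. -/
def clsMap {hT : LmClosed T} {Γ Δ : List Sg.Srt} (f : ClsHom hT Γ Δ) :
    clsPoset hT Δ ⟶ clsPoset hT Γ :=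
  PartOrd.ofHom ⟨ClsFib.re f, ClsFib.re_mono f⟩

/-- The contravariant functor of formulas up to interderivability. -/
def clsFunctor (hT : LmClosed T) : (ClsObj hT)ᵒᵖ ⥤ PartOrd.{max u s} where
  obj Γ := clsPoset hT Γ.unop
  map f := clsMap f.unop
  map_id Γ := PartOrd.ext fun r => ClsFib.re_id r
  map_comp {Γ Δ Θ} f g := PartOrd.ext fun r => by
    obtain ⟨f⟩ := f
    obtain ⟨g⟩ := g
    induction f using ClsHom.ind with | _ γ
    induction g using ClsHom.ind with | _ δ
    exact ClsFib.re_comp δ γ r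

theorem cls_whiskerRight (hT : LmClosed T) {Γ Γ' : ClsObj hT} (γ : Subst Sg Γ' Γ)
    (Δ : ClsObj hT) : @whiskerRight (ClsObj hT) _ _ Γ' Γ (ClsHom.mk hT γ) Δ =
      ClsHom.mk hT (γ.liftN Δ) := by
  apply CartesianMonoidalCategory.hom_ext
  · refine (whiskerRight_fst _ _).trans ?_
    exact congrArg (ClsHom.mk hT)
      (funext fun σ => funext fun x => (Subst.liftN_right γ x Δ).symm)
  · refine (whiskerRight_snd _ _).trans ?_
    exact congrArg (ClsHom.mk hT)
      (funext fun σ => funext fun x => (Subst.liftN_left γ x).symm)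

theorem cls_associator_inv (hT : LmClosed T) (Γ Δ Θ : ClsObj hT) :
    (α_ Γ Δ Θ).inv = ClsHom.mk hT (Subst.assoc Γ Δ Θ) := by
  apply CartesianMonoidalCategory.hom_ext
  · apply CartesianMonoidalCategory.hom_ext
    · refine (Category.assoc _ _ _).trans ((associator_inv_fst_fst _ _ _).trans ?_)
      exact congrArg (ClsHom.mk hT)
        (funext fun σ => funext fun x => (Subst.assoc_right_right Γ Δ x Θ).symm)
    · refine (Category.assoc _ _ _).trans ((associator_inv_fst_snd _ _ _).trans ?_)
      exact congrArg (ClsHom.mk hT)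
        (funext fun σ => funext fun x => (Subst.assoc_left_right Γ Δ x Θ).symm)
  · refine (associator_inv_snd _ _ _).trans ?_
    exact congrArg (ClsHom.mk hT)
      (funext fun σ => funext fun x => (Subst.assoc_left Γ Δ x).symm)

/-- The equality predicate on a context. -/
def ClsFib.eqPred (hT : LmClosed T) (Γ : List Sg.Srt) : ClsFib hT (Γ ++ Γ) :=
  ClsFib.mk hT (Formula.eqAll Γ (Subst.fst Γ Γ) (Subst.snd Γ Γ))

theorem ClsFib.eqPred_append (hT : LmClosed T) (Γ Δ : List Sg.Srt) :
    ClsFib.eqPred hT (Δ ++ Γ) = ClsFib.conn L.tensor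
      ![ClsFib.re (ClsHom.pair
          (ClsHom.mk hT ((Subst.fst (Δ ++ Γ) (Δ ++ Γ)).comp (Subst.fst Γ Δ)))
          (ClsHom.mk hT ((Subst.snd (Δ ++ Γ) (Δ ++ Γ)).comp (Subst.fst Γ Δ))))
          (ClsFib.eqPred hT Γ),
        ClsFib.re (ClsHom.pair
          (ClsHom.mk hT ((Subst.fst (Δ ++ Γ) (Δ ++ Γ)).comp (Subst.snd Γ Δ)))
          (ClsHom.mk hT ((Subst.snd (Δ ++ Γ) (Δ ++ Γ)).comp (Subst.snd Γ Δ))))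
          (ClsFib.eqPred hT Δ)] := by
  refine (ClsFib.eqAll_append hT Δ _ _).trans ?_
  refine (ClsFib.tens_mk hT _ _).symm.trans ?_
  have key : ∀ (Ξ : List Sg.Srt) (γ δ : Subst Sg ((Δ ++ Γ) ++ (Δ ++ Γ)) Ξ),
      ClsFib.mk hT (Formula.eqAll Ξ γ δ) =
        ClsFib.re (ClsHom.pair (ClsHom.mk hT γ) (ClsHom.mk hT δ)) (ClsFib.eqPred hT Ξ) := by
    intro Ξ γ δ
    refine (congrArg (ClsFib.mk hT) ?_).trans
      (congrArg (ClsFib.mk hT) (Formula.eqAll_subst (γ.pair δ) Ξ _ _).symm)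
    congr 1
    · funext σ x; exact (Subst.pair_right γ x δ).symm
    · funext σ x; exact (Subst.pair_left γ δ x).symm
  rw [← key, ← key]
  rfl

/-- The classifying prop-category of a theory of the minimal logic: contexts and lists of terms up
to provable equality, with the posets of formulas up to interderivability. -/
noncomputable def classifying (hT : LmClosed T) : PropCat.{u, s, s, max u s} L where
  C := ClsObj hT
  P := clsFunctor hT
  conn _ _ k r := ClsFib.conn k r
  map_conn f _ k r := ClsFib.re_conn f k r
  EqPred Γ := ClsFib.eqPred hT Γ
  quant Q Γ Δ := ClsFib.quant Q Γ Δ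
  quant_natural Q {Γ Γ'} f Δ r := by
    induction f using ClsHom.ind with | _ γ
    rw [cls_whiskerRight]
    exact ClsFib.quant_re Q γ Δ r
  tensor_assoc _ := ClsFib.conn_assoc
  unit_tensor _ := ClsFib.unit_conn
  tensor_unit _ := ClsFib.conn_unit
  quant_one Q Γ r := (ClsFib.quant_nil Q _).trans (ClsFib.re_id r)
  quant_prod Q Γ Δ Θ r := by
    rw [cls_associator_inv]
    exact ClsFib.quant_assoc Q Γ Δ Θ r
  EqPred_one := (ClsFib.one_mk hT _).symm
  EqPred_prod Γ Δ := ClsFib.eqPred_append hT Γ Δ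

end Classifying

/-- The variables of `Γ`, as a list of terms indexed by the context interpreting `Γ` in the
classifying prop-category, where each sort `σ` is interpreted by the context `x : σ`. -/
noncomputable def genVars {L : Language.{u}} {Sg : Signature.{s}} {T : Theory L Sg} (hT : LmClosed T) :
    ∀ Γ : List Sg.Srt,
      Subst Sg ((classifying hT).ctx (fun σ => ([σ] : List Sg.Srt)) Γ : List Sg.Srt) Γ
  | _ :: _, _, .zero => .var .zero
  | _ :: Γ, _, .succ x => (genVars hT Γ _ x).subst (Subst.fst _ [_])

/-- The generic structure in the classifying prop-category: a sort `σ` is interpreted by the context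
`x : σ`, a function symbol `f` by the term `f(x₁, …, xₙ)` and a relation symbol `R` by the formula
`R(x₁, …, xₙ)`. -/
noncomputable def generic {L : Language.{u}} {Sg : Signature.{s}} {T : Theory L Sg}
    (hT : LmClosed T) : Str Sg (classifying hT) where
  sort σ := ([σ] : List Sg.Srt)
  func f := ClsHom.mk hT fun
    | _, .zero => .app f (genVars hT (Sg.dom f))
  rel R := ClsFib.mk hT (.rel R (genVars hT (Sg.ar R)))

/-! ## `Sg`-structures as morphisms out of the formula prop-category -/

/-- The formula prop-category `(C_Sg, P_Sg)`. -/
noncomputable abbrev formulaCat (L : Language.{u}) (Sg : Signature.{s}) :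
    PropCat.{u, s, s, max u s} L :=
  classifying (minTheory_closed L Sg)

/-- An object of the coslice category under the formula prop-category, that is, an `Sg`-structure
presented as a morphism of `FA`. -/
structure SgStructure (L : Language.{u}) (Sg : Signature.{u}) where
  /-- the prop-category in which the structure lives -/
  cod : PropCat.{u, max u v, max u w, max u p} L
  /-- the structure -/
  mor : Mor (formulaCat L Sg) cod

/-- The assertion `a` belongs to the kernel of the structure: the two terms, respectively the
tensor of the hypotheses and the conclusion, which are regarded as morphisms and predicates of the
formula prop-category, have equal, respectively ordered, images. -/
def SgStructure.InKer {L : Language.{u}} {Sg : Signature.{u}}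
    (F : SgStructure.{u, v, w, p} L Sg) : Assertion L Sg → Prop
  | .eqn M N => F.mor.o.map ((generic (minTheory_closed L Sg)).term M) =
      F.mor.o.map ((generic (minTheory_closed L Sg)).term N)
  | .seq (Γ := Γ) Φ ψ =>
      F.mor.p _ ((formulaCat L Sg).tensList ((generic (minTheory_closed L Sg)).ctx Γ)
        (Φ.map fun φ => (generic (minTheory_closed L Sg)).form φ)) ≤
      F.mor.p _ ((generic (minTheory_closed L Sg)).form ψ)

section Operators

variable {L : Language.{u}} (𝓛 : Logic.{u, s} L) {Sg : Signature.{u}}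

/-- The class of all `Sg`-structures in objects of `FA_𝓛`. -/
def AllStr (Sg : Signature.{u}) : Set (SgStructure.{u, v, w, p} L Sg) :=
  {F | 𝓛.Sound F.cod}

/-- The common theory of a class of structures. -/
def Th (Y : Set (SgStructure.{u, v, w, p} L Sg)) : Theory L Sg :=
  {a | ∀ F ∈ Y, F.InKer a}

/-- The class of all models of `T` in objects of `FA_𝓛`. -/
def Mod (T : Theory L Sg) : Set (SgStructure.{u, v, w, p} L Sg) :=
  {F | 𝓛.Sound F.cod ∧ ∀ a ∈ T, F.InKer a}

/-- The least class containing `Y` and closed under external products, indexed by sets. -/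
inductive ProdClosure (Y : Set (SgStructure.{u, v, w, p} L Sg)) :
    Set (SgStructure.{u, v, w, p} L Sg)
  | base {F : SgStructure.{u, v, w, p} L Sg} : F ∈ Y → ProdClosure Y F
  | prod {I : Type u} (F : I → SgStructure.{u, v, w, p} L Sg) :
      (∀ i, ProdClosure Y (F i)) →
      ProdClosure Y ⟨PropCat.pi.{u, v, w, p} fun i => (F i).cod, Mor.pi fun i => (F i).mor⟩

/-- The least class containing `Y` and closed under external submodels: if `H = ι ∘ K` for a
subprop-morphism `ι` of `FA_𝓛`, then `K` is a submodel of `H`. -/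
inductive SubClosure (Y : Set (SgStructure.{u, v, w, p} L Sg)) :
    Set (SgStructure.{u, v, w, p} L Sg)
  | base {F : SgStructure.{u, v, w, p} L Sg} : F ∈ Y → SubClosure Y F
  | sub {D E : PropCat.{u, max u v, max u w, max u p} L} (K : Mor (formulaCat L Sg) E)
      (ι : Mor E D) : 𝓛.Sound D → 𝓛.Sound E → ι.IsSubprop →
      SubClosure Y ⟨D, ι.comp K⟩ → SubClosure Y ⟨E, K⟩

/-- The least class containing `Y` and closed under external homomorphic images `H ∘ F` of `F`, for
morphisms `H` of `FA_𝓛`. -/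
inductive HomClosure (Y : Set (SgStructure.{u, v, w, p} L Sg)) :
    Set (SgStructure.{u, v, w, p} L Sg)
  | base {F : SgStructure.{u, v, w, p} L Sg} : F ∈ Y → HomClosure Y F
  | img {D E : PropCat.{u, max u v, max u w, max u p} L} (F : Mor (formulaCat L Sg) D)
      (H : Mor D E) : 𝓛.Sound D → 𝓛.Sound E →
      HomClosure Y ⟨D, F⟩ → HomClosure Y ⟨E, H.comp F⟩

end Operators

end FibHSP

/-!
The inclusion of the closure `HSP(Y)` in the class of models of `Th Y` holds because kernels are
preserved by each of the three operations: a product satisfies what all its factors satisfy,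
subprop-morphisms reflect kernels, and homomorphic images preserve them. Products stay inside
`FA_𝓛`: a family of morphisms that is jointly faithful and jointly reflects the order of the fibres
also reflects satisfaction of assertions in structures over any signature, hence soundness
(`Logic.Sound.of_jointly_conservative`). The projections of a product form such a family.

For the converse, the signature being small, one member of `Y` is chosen for each assertion outside
`Th Y` to refute it. The product `G` of these structures has kernel exactly `Th Y`
(`exists_mem_prodClosure_inKer_iff`). It factors through its image `Mor.image G`, the prop-category
with the objects of the formula prop-category whose morphisms and predicates are those of the form
`G f` and `G r`. The inclusion of the image is a subprop-morphism, so the image is again in `FA_𝓛`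
and the corestriction of `G` is a submodel of `G`. A model `F` of `Th Y` has a kernel containing
that of `G`, in terms of assertions. Since the generic structure interprets terms and formulas by
themselves, up to a renaming of variables that can be undone (`generic_term`, `generic_form`,
`exists_comp_genVars`), `F` respects all equalities of morphisms and inequalities of predicates that
hold in the image of `G` (`SgStructure.map_eq_of_inKer`, `SgStructure.le_of_inKer`). So `F` factors
through the corestriction of `G` (`Mor.imageDesc`), and is a homomorphic image of it.
-/

namespace FibHSP

/-! ### Transport of structures along morphisms -/

namespace PropCat

variable {L : Language.{u}}

theorem comp_tuple (D : PropCat.{u, v, w, p} L) {S : Type s} (X : S → D.C) {Y Z : D.C}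
    (f : Z ⟶ Y) : ∀ (Δ : List S) (m : ∀ σ, Var Δ σ → (Y ⟶ X σ)),
      f ≫ D.tuple X Δ m = D.tuple X Δ fun σ x => f ≫ m σ x
  | [], _ => toUnit_unique _ _
  | σ :: Δ, m => by
    change f ≫ lift _ _ = lift _ _
    rw [comp_lift, comp_tuple D X f Δ]

theorem re_tensList (D : PropCat.{u, v, w, p} L) {c d : D.C} (f : c ⟶ d) :
    ∀ l : List (D.Fib d), D.re f (D.tensList d l) = D.tensList c (l.map (D.re f))
  | [] => (D.map_conn f L.unit ![]).trans (congrArg _ (funext fun i => i.elim0))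
  | r :: l => by
    refine (D.map_conn f L.tensor _).trans (congrArg (D.conn c L.tensor) ?_)
    funext i
    fin_cases i
    · rfl
    · exact re_tensList D f l

theorem tensList_singleton (D : PropCat.{u, v, w, p} L) (c : D.C) (r : D.Fib c) :
    D.tensList c [r] = r :=
  D.tensor_unit c r

theorem re_le_re_iff (D : PropCat.{u, v, w, p} L) {c d : D.C} (f : c ⟶ d) [IsIso f]
    {r r' : D.Fib d} : D.re f r ≤ D.re f r' ↔ r ≤ r' := by
  refine ⟨fun h => ?_, D.re_mono f⟩
  have := D.re_mono (inv f) h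
  rwa [← re_comp, ← re_comp, IsIso.inv_hom_id, re_id, re_id] at this

end PropCat

namespace Mor

variable {L : Language.{u}} {A : PropCat.{u, v₁, w₁, p₁} L} {B : PropCat.{u, v₂, w₂, p₂} L}

theorem map_tensList (F : Mor A B) (c : A.C) : ∀ l : List (A.Fib c),
    F.p c (A.tensList c l) = B.tensList (F.o.obj c) (l.map (F.p c))
  | [] => (F.map_conn c L.unit ![]).trans (congrArg _ (funext fun i => i.elim0))
  | r :: l => by
    refine (F.map_conn c L.tensor _).trans (congrArg (B.conn (F.o.obj c) L.tensor) ?_)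
    funext i
    fin_cases i
    · rfl
    · exact map_tensList F c l

/-- The canonical comparison `F⟦Γ⟧ ⟶ ⟦Γ⟧` between the image of the product of the objects `X σ` and
the product of their images. -/
noncomputable def ctxComparison (F : Mor A B) {S : Type s} (X : S → A.C) :
    ∀ Γ : List S, F.o.obj (A.ctx X Γ) ⟶ B.ctx (fun σ => F.o.obj (X σ)) Γ
  | [] => terminalComparison F.o
  | σ :: Γ => prodComparison F.o (A.ctx X Γ) (X σ) ≫ F.ctxComparison X Γ ▷ F.o.obj (X σ)

instance isIso_ctxComparison (F : Mor A B) {S : Type s} (X : S → A.C) :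
    ∀ Γ : List S, IsIso (F.ctxComparison X Γ)
  | [] => inferInstanceAs (IsIso (terminalComparison F.o))
  | σ :: Γ => by
    have : IsIso (F.ctxComparison X Γ) := isIso_ctxComparison F X Γ
    exact inferInstanceAs (IsIso (prodComparison F.o (A.ctx X Γ) (X σ) ≫
      F.ctxComparison X Γ ▷ F.o.obj (X σ)))

theorem ctxComparison_proj (F : Mor A B) {S : Type s} (X : S → A.C) {τ : S} :
    ∀ {Γ : List S} (x : Var Γ τ),
      F.ctxComparison X Γ ≫ B.proj (fun σ => F.o.obj (X σ)) x = F.o.map (A.proj X x)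
  | _ :: _, .zero => by
    change (_ ≫ _) ≫ snd _ _ = F.o.map (snd _ _)
    rw [Category.assoc, whiskerRight_snd, prodComparison_snd]
  | _ :: _, .succ x => by
    change (_ ≫ _) ≫ fst _ _ ≫ _ = F.o.map (fst _ _ ≫ _)
    rw [Category.assoc, whiskerRight_fst_assoc, prodComparison_fst_assoc, F.o.map_comp,
      ctxComparison_proj F X x]

theorem map_tuple (F : Mor A B) {S : Type s} (X : S → A.C) {Y : A.C} :
    ∀ (Δ : List S) (m : ∀ σ, Var Δ σ → (Y ⟶ X σ)),
      F.o.map (A.tuple X Δ m) ≫ F.ctxComparison X Δ =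
        B.tuple (fun σ => F.o.obj (X σ)) Δ fun σ x => F.o.map (m σ x)
  | [], _ => toUnit_unique _ _
  | σ :: Δ, m => by
    change F.o.map (lift _ _) ≫ _ ≫ _ = lift _ _
    apply CartesianMonoidalCategory.hom_ext
    · rw [Category.assoc, Category.assoc, whiskerRight_fst, prodComparison_fst_assoc,
        ← F.o.map_comp_assoc, lift_fst, lift_fst, map_tuple F X Δ]
    · rw [Category.assoc, Category.assoc, whiskerRight_snd, prodComparison_snd,
        ← F.o.map_comp, lift_snd, lift_snd]

variable {Sg : Signature.{s}}

/-- The image `F∘S` of a structure under a morphism of prop-categories: function and relation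
symbols are interpreted by the images of their interpretations, transported along the comparison
`F⟦Γ⟧ ≅ ⟦Γ⟧`. -/
noncomputable abbrev push (F : Mor A B) (S : Str Sg A) : Str Sg B where
  sort σ := F.o.obj (S.sort σ)
  func f := inv (F.ctxComparison S.sort (Sg.dom f)) ≫ F.o.map (S.func f)
  rel R := B.re (inv (F.ctxComparison S.sort (Sg.ar R))) (F.p _ (S.rel R))

theorem push_term (F : Mor A B) (S : Str Sg A) {Γ : List Sg.Srt} {τ : Sg.Srt}
    (M : Term Sg Γ τ) :
    F.ctxComparison S.sort Γ ≫ (F.push S).term M = F.o.map (S.term M) := by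
  induction M with
  | var x => exact F.ctxComparison_proj S.sort x
  | app f a ih =>
    simp only [Str.term]
    rw [F.o.map_comp, ← Category.assoc, PropCat.comp_tuple]
    simp only [ih]
    rw [← F.map_tuple S.sort, Category.assoc, IsIso.hom_inv_id_assoc]

theorem push_tuple (F : Mor A B) (S : Str Sg A) {Γ Δ : List Sg.Srt}
    (a : ∀ σ, Var Δ σ → Term Sg Γ σ) :
    F.ctxComparison S.sort Γ ≫ B.tuple (fun σ => F.o.obj (S.sort σ)) Δ
        (fun σ x => (F.push S).term (a σ x)) =
      F.o.map (A.tuple S.sort Δ fun σ x => S.term (a σ x)) ≫ F.ctxComparison S.sort Δ := by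
  rw [F.map_tuple, PropCat.comp_tuple]
  simp only [push_term]

theorem push_form (F : Mor A B) (S : Str Sg A) {Γ : List Sg.Srt} (φ : Formula L Sg Γ) :
    B.re (F.ctxComparison S.sort Γ) ((F.push S).form φ) = F.p _ (S.form φ) := by
  induction φ with
  | rel R a =>
    simp only [Str.form]
    rw [F.natural, ← PropCat.re_comp, push_tuple, ← PropCat.re_comp, Category.assoc,
      IsIso.hom_inv_id, Category.comp_id]
  | eq M N =>
    simp only [Str.form]
    rw [F.natural, F.map_EqPred, ← PropCat.re_comp, ← PropCat.re_comp]
    congr 1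
    rw [comp_lift, push_term, push_term]
    apply CartesianMonoidalCategory.hom_ext
    · simp [← F.o.map_comp]
    · simp [← F.o.map_comp]
  | conn c φ ih =>
    change B.re _ (B.conn _ c _) = F.p _ (A.conn _ c _)
    rw [F.map_conn]
    refine (B.map_conn _ c _).trans ?_
    exact congrArg _ (funext ih)
  | @quant Γ Q σ φ ih =>
    refine Eq.trans ?_ (F.map_quant Q (S.ctx Γ) (S.sort σ) (S.form φ)).symm
    refine (B.quant_natural Q _ _ _).symm.trans ?_
    refine congrArg _ ?_
    have ih' := congrArg (B.re (inv (prodComparison F.o (S.ctx Γ) (S.sort σ)))) ih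
    refine Eq.trans ?_ ih'
    refine Eq.trans ?_ (B.re_comp _ _ _)
    refine congrArg (fun f => B.re f _) ?_
    exact (IsIso.inv_hom_id_assoc _ _).symm

theorem push_sat_eqn (F : Mor A B) (S : Str Sg A) {Γ : List Sg.Srt} {τ : Sg.Srt}
    (M N : Term Sg Γ τ) : (F.push S).Sat (.eqn M N : Assertion L Sg) ↔
      F.o.map (S.term M) = F.o.map (S.term N) := by
  rw [← push_term, ← push_term]
  exact (cancel_epi (F.ctxComparison S.sort Γ)).symm

theorem push_sat_seq (F : Mor A B) (S : Str Sg A) {Γ : List Sg.Srt}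
    (Φ : List (Formula L Sg Γ)) (ψ : Formula L Sg Γ) : (F.push S).Sat (.seq Φ ψ) ↔
      F.p _ (A.tensList _ (Φ.map fun φ => S.form φ)) ≤ F.p _ (S.form ψ) := by
  rw [map_tensList, ← push_form, List.map_map]
  refine (B.re_le_re_iff (F.ctxComparison S.sort Γ)).symm.trans ?_
  rw [PropCat.re_tensList, List.map_map]
  refine iff_of_eq (congrArg (fun l => B.tensList _ l ≤ _) ?_)
  exact List.map_congr_left fun φ _ => F.push_form S φ

theorem push_sat (F : Mor A B) (S : Str Sg A) {a : Assertion L Sg} (h : S.Sat a) :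
    (F.push S).Sat a := by
  cases a with
  | eqn M N => exact (F.push_sat_eqn S M N).2 (congrArg F.o.map h)
  | seq Φ ψ => exact (F.push_sat_seq S Φ ψ).2 ((F.p _).monotone h)

end Mor

/-! ### Soundness -/

/-- Soundness is reflected by families of morphisms that are jointly faithful and jointly reflect
the order of the fibres: such a family reflects satisfaction of assertions. -/
theorem Logic.Sound.of_jointly_conservative {L : Language.{u}} {𝓛 : Logic.{u, s} L}
    {A : PropCat.{u, v₁, w₁, p₁} L} {I : Type*} {B : I → PropCat.{u, v₂, w₂, p₂} L}
    (F : ∀ i, Mor A (B i)) (hB : ∀ i, 𝓛.Sound (B i))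
    (ho : ∀ {c d : A.C} (f g : c ⟶ d), (∀ i, (F i).o.map f = (F i).o.map g) → f = g)
    (hp : ∀ {c : A.C} (r r' : A.Fib c), (∀ i, (F i).p c r ≤ (F i).p c r') → r ≤ r') :
    𝓛.Sound A := by
  intro Sg T T' hT S hS a ha
  have h : ∀ i, ((F i).push S).Sat a := fun i =>
    hB i Sg T T' hT _ (fun b hb => (F i).push_sat S (hS b hb)) a ha
  cases a with
  | eqn M N => exact ho _ _ fun i => ((F i).push_sat_eqn S M N).1 (h i)
  | seq Φ ψ => exact hp _ _ fun i => ((F i).push_sat_seq S Φ ψ).1 (h i)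

theorem Mor.IsSubprop.sound {L : Language.{u}} {𝓛 : Logic.{u, s} L}
    {A : PropCat.{u, v₁, w₁, p₁} L} {B : PropCat.{u, v₂, w₂, p₂} L} {F : Mor A B}
    (hF : F.IsSubprop) (hB : 𝓛.Sound B) : 𝓛.Sound A :=
  have := hF.faithful
  .of_jointly_conservative (fun _ : Unit => F) (fun _ => hB)
    (fun _ _ h => F.o.map_injective (h ())) fun r r' h => (hF.embedding _ r r').1 (h ())

section Product

variable {L : Language.{u}} {I : Type u} (D : I → PropCat.{u, max u v, max u w, max u p} L)

/-- The projection functors of a product of prop-categories. -/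
def PropCat.piEval (i : I) : (PropCat.pi.{u, v, w, p} D).C ⥤ (D i).C where
  obj c := c i
  map f := f i

theorem prodComparison_piEval (i : I) (b c : (PropCat.pi.{u, v, w, p} D).C) :
    prodComparison (PropCat.piEval D i) b c = 𝟙 (b i ⊗ c i) := by
  apply CartesianMonoidalCategory.hom_ext
  · exact (prodComparison_fst _ _ _).trans (Category.id_comp _).symm
  · exact (prodComparison_snd _ _ _).trans (Category.id_comp _).symm

theorem PropCat.piEval_preserves (i : I) :
    Limits.PreservesFiniteProducts (PropCat.piEval.{u, v, w, p} D i) :=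
  preservesFiniteProducts_of_comparison _
    ((toUnit_unique _ _ : 𝟙 (𝟙_ (D i).C) = terminalComparison (PropCat.piEval D i)) ▸
      (inferInstance : IsIso (𝟙 (𝟙_ (D i).C))))
    fun b c => (prodComparison_piEval D i b c).symm ▸ (inferInstance : IsIso (𝟙 (b i ⊗ c i)))

/-- The projections of a product of prop-categories. -/
noncomputable def Mor.piProj (i : I) : Mor (PropCat.pi.{u, v, w, p} D) (D i) where
  o := PropCat.piEval D i
  preserves := PropCat.piEval_preserves D i
  p c := ⟨fun r => r i, fun _ _ h => h i⟩
  natural f r := rfl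
  map_conn c _ k r := rfl
  map_quant Q b c r := by
    have := PropCat.piEval_preserves D i
    refine congrArg ((D i).quant Q (b i) (c i)) ?_
    refine ((D i).re_id (b i ⊗ c i) (r i)).symm.trans ?_
    refine congrArg (fun f => (D i).re f (r i)) ?_
    have h : IsIso (prodComparison (PropCat.piEval.{u, v, w, p} D i) b c) := inferInstance
    refine IsIso.eq_inv_of_hom_inv_id (f := prodComparison (PropCat.piEval D i) b c) ?_
    exact (Category.comp_id _).trans (prodComparison_piEval D i b c)
  map_EqPred c := by
    refine ((D i).re_id (c i ⊗ c i) ((D i).EqPred (c i))).symm.trans ?_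
    exact congrArg (fun f => (D i).re f _) (prodComparison_piEval D i c c).symm

theorem PropCat.sound_pi {𝓛 : Logic.{u, s} L} (h : ∀ i, 𝓛.Sound (D i)) :
    𝓛.Sound (PropCat.pi.{u, v, w, p} D) :=
  .of_jointly_conservative (Mor.piProj D) h (fun _ _ h => funext h) fun _ _ h => h

end Product

/-! ### The generic structure and kernels -/

theorem map_comp_congr_right {C : Type v₁} [Category.{w₁} C] {D : Type v₂} [Category.{w₂} D]
    (F : C ⥤ D) {X Y Z : C} (f : X ⟶ Y) {g g' : Y ⟶ Z} (h : F.map g = F.map g') :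
    F.map (f ≫ g) = F.map (f ≫ g') := by
  rw [F.map_comp, F.map_comp, h]

theorem map_comp_congr_left {C : Type v₁} [Category.{w₁} C] {D : Type v₂} [Category.{w₂} D]
    (F : C ⥤ D) {X Y Z : C} {f f' : X ⟶ Y} (h : F.map f = F.map f') (g : Y ⟶ Z) :
    F.map (f ≫ g) = F.map (f' ≫ g) := by
  rw [F.map_comp, F.map_comp, h]

theorem map_eq_of_fst_of_snd {C : Type v₁} [Category.{w₁} C] [CartesianMonoidalCategory C]
    {D : Type v₂} [Category.{w₂} D] [CartesianMonoidalCategory D] (F : C ⥤ D)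
    [Limits.PreservesFiniteProducts F] {X Y Z : C} {f g : X ⟶ Y ⊗ Z}
    (h : F.map (f ≫ fst Y Z) = F.map (g ≫ fst Y Z))
    (h' : F.map (f ≫ snd Y Z) = F.map (g ≫ snd Y Z)) : F.map f = F.map g := by
  refine (cancel_mono (prodComparison F Y Z)).1 ?_
  apply CartesianMonoidalCategory.hom_ext
  · rw [Category.assoc, Category.assoc, prodComparison_fst, ← F.map_comp, h, F.map_comp]
  · rw [Category.assoc, Category.assoc, prodComparison_snd, ← F.map_comp, h', F.map_comp]

theorem Mor.re_le_re {L : Language.{u}} {A : PropCat.{u, v₁, w₁, p₁} L}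
    {B : PropCat.{u, v₂, w₂, p₂} L} (F : Mor A B) {c d : A.C} (f : c ⟶ d) {r r' : A.Fib d}
    (h : F.p d r ≤ F.p d r') : F.p c (A.re f r) ≤ F.p c (A.re f r') := by
  rw [F.natural, F.natural]
  exact B.re_mono _ h

section Generic

variable {L : Language.{u}} {Sg : Signature.{s}} {T : Theory L Sg}

/-- A single term, as a list of terms. -/
def Term.single {Γ : List Sg.Srt} {τ : Sg.Srt} (M : Term Sg Γ τ) : Subst Sg Γ [τ]
  | _, .zero => M

theorem Subst.single_zero {Γ : List Sg.Srt} {τ : Sg.Srt} (γ : Subst Sg Γ [τ]) :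
    (γ τ .zero).single = γ := by
  funext σ x
  cases x with
  | zero => rfl
  | succ x => cases x

/-- The morphism into `⟦Δ⟧` with components `γ` is given by a list `δ` of terms, from which `γ` is
recovered by substituting `δ` in the canonical list `genVars`. -/
theorem classifying_tuple_genVars (hT : LmClosed T) {Θ : List Sg.Srt} :
    ∀ {Δ : List Sg.Srt} (γ : Subst Sg Θ Δ), ∃ δ : Subst Sg Θ
      ((classifying hT).ctx (fun σ => ([σ] : List Sg.Srt)) Δ : List Sg.Srt),
      (classifying hT).tuple (Y := Θ) (generic hT).sort Δ
        (fun σ x => ClsHom.mk hT (γ σ x).single) = ClsHom.mk hT δ ∧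
      δ.comp (genVars hT Δ) = γ
  | [], γ => ⟨Subst.empty Θ, rfl, funext fun _ => funext fun x => nomatch x⟩
  | σ :: Δ, γ => by
    obtain ⟨δ, h, h'⟩ := classifying_tuple_genVars hT (Δ := Δ) fun _ x => γ _ x.succ
    refine ⟨δ.pair (γ σ .zero).single, ?_, ?_⟩
    · exact congrArg (fun f => ClsHom.pair f (ClsHom.mk hT (γ σ .zero).single)) h
    · funext τ x
      cases x with
      | zero => rfl
      | succ x =>
        refine (Term.subst_subst _ _ _).trans (Eq.trans ?_ (congrFun (congrFun h' τ) x))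
        refine congrArg (fun ε => (genVars hT Δ τ x).subst ε) ?_
        funext ρ y
        exact Subst.pair_right δ y (γ σ .zero).single

theorem generic_proj (hT : LmClosed T) {τ : Sg.Srt} : ∀ {Γ : List Sg.Srt} (x : Var Γ τ),
    (classifying hT).proj (generic hT).sort x = ClsHom.mk hT (genVars hT Γ τ x).single
  | _ :: _, .zero => congrArg (ClsHom.mk hT) (Subst.single_zero _).symm
  | σ :: Γ, .succ x => by
    refine (congrArg (fun f => fst ((classifying hT).ctx (generic hT).sort Γ)
      ((generic hT).sort σ) ≫ f) (generic_proj hT x)).trans ?_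
    exact congrArg (ClsHom.mk hT) (Subst.single_zero _).symm

/-- The generic structure interprets a term by itself, up to the renaming `genVars` of its
variables. -/
theorem generic_term (hT : LmClosed T) {Γ : List Sg.Srt} {τ : Sg.Srt} (M : Term Sg Γ τ) :
    (generic hT).term M = ClsHom.mk hT (M.subst (genVars hT Γ)).single := by
  induction M with
  | var x => exact generic_proj hT x
  | app f a ih =>
    have ih' : (fun σ x => (generic hT).term (a σ x)) =
        fun σ x => ClsHom.mk hT ((a σ x).subst (genVars hT Γ)).single :=
      funext fun σ => funext fun x => ih σ x
    obtain ⟨δ, h, h'⟩ := classifying_tuple_genVars hT (fun σ x => (a σ x).subst (genVars hT Γ))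
    have h := (congrArg ((classifying hT).tuple (generic hT).sort (Sg.dom f)) ih').trans h
    refine (congrArg (fun g => g ≫ (generic hT).func f) h).trans ?_
    refine congrArg (ClsHom.mk hT) ((Subst.single_zero _).symm.trans ?_)
    exact congrArg (fun a => (Term.app f a).single) h'

/-- The generic structure interprets a formula by its class, up to the renaming `genVars` of its
variables. -/
theorem generic_form (hT : LmClosed T) {Γ : List Sg.Srt} (φ : Formula L Sg Γ) :
    (generic hT).form φ = ClsFib.mk hT (φ.subst (genVars hT Γ)) := by
  induction φ with
  | @rel Γ R a =>
    have ih' : (fun σ x => (generic hT).term (a σ x)) =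
        fun σ x => ClsHom.mk hT ((a σ x).subst (genVars hT Γ)).single :=
      funext fun σ => funext fun x => generic_term hT (a σ x)
    obtain ⟨δ, h, h'⟩ := classifying_tuple_genVars hT (fun σ x => (a σ x).subst (genVars hT Γ))
    have h := (congrArg ((classifying hT).tuple (generic hT).sort (Sg.ar R)) ih').trans h
    refine (congrArg (fun g => (classifying hT).re g ((generic hT).rel R)) h).trans ?_
    exact congrArg (fun a => ClsFib.mk hT (Formula.rel R a)) h'
  | @eq Γ σ M N =>
    simp only [Str.form]
    rw [generic_term, generic_term]
    refine (congrArg (ClsFib.mk hT) (Formula.eqAll_subst _ [σ] _ _)).trans ?_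
    -- The equality predicate of a one-variable context is `e ⊗ (x = y)`.
    exact ClsFib.one_tens hT _
  | conn c φ ih =>
    refine (congrArg _ (funext ih)).trans ?_
    exact ClsFib.conn_mk hT c _
  | @quant Γ Q σ φ ih =>
    refine (congrArg (fun r => ClsFib.quant Q _ [σ] r) ih).trans ?_
    refine congrArg (fun γ => ClsFib.mk hT (Formula.quant Q σ (φ.subst γ))) ?_
    funext τ x
    cases x with
    | zero => rfl
    | succ x => exact (Term.ren_eq_subst _ _).symm

/-- The renaming `genVars` can be undone by a substitution, so that no information on a term or a
formula is lost in its interpretation in the generic structure. -/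
theorem exists_comp_genVars (hT : LmClosed T) (Γ : List Sg.Srt) : ∃ δ : Subst Sg Γ
    ((classifying hT).ctx (fun σ => ([σ] : List Sg.Srt)) Γ : List Sg.Srt),
    δ.comp (genVars hT Γ) = Subst.id Γ := by
  obtain ⟨δ, -, h⟩ := classifying_tuple_genVars hT (Subst.id Γ)
  exact ⟨δ, h⟩

end Generic

namespace SgStructure

variable {L : Language.{u}} {Sg : Signature.{u}}

/-- The morphism `Γ ⟶ Δ` of the formula prop-category given by a list of terms. -/
def hom (L : Language.{u}) {Γ Δ : List Sg.Srt} (γ : Subst Sg Γ Δ) :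
    @Quiver.Hom (formulaCat L Sg).C _ Γ Δ :=
  ClsHom.mk (minTheory_closed L Sg) γ

/-- The predicate of the formula prop-category given by a formula. -/
def pred {Γ : List Sg.Srt} (φ : Formula L Sg Γ) : (formulaCat L Sg).Fib Γ :=
  ClsFib.mk (minTheory_closed L Sg) φ

theorem inKer_eqn (F : SgStructure.{u, v, w, p} L Sg) {Γ : List Sg.Srt} {τ : Sg.Srt}
    (M N : Term Sg Γ τ) : F.InKer (.eqn M N) ↔
      F.mor.o.map (hom L M.single) = F.mor.o.map (hom L N.single) := by
  obtain ⟨δ, hδ⟩ := exists_comp_genVars (minTheory_closed L Sg) Γ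
  have h : ∀ M : Term Sg Γ τ, hom L δ ≫ (generic (minTheory_closed L Sg)).term M =
      hom L M.single := by
    intro M
    rw [generic_term]
    refine congrArg (hom L) ((Subst.single_zero _).symm.trans (congrArg Term.single ?_))
    refine (Term.subst_subst _ _ _).trans ?_
    rw [hδ, Term.subst_id]
  have h' : ∀ M : Term Sg Γ τ, (generic (minTheory_closed L Sg)).term M =
      hom L (genVars (minTheory_closed L Sg) Γ) ≫ hom L M.single := by
    intro M
    rw [generic_term]
    exact congrArg (hom L) (Subst.single_zero ((genVars _ Γ).comp M.single))
  constructor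
  · intro (k : F.mor.o.map _ = F.mor.o.map _)
    rw [← h M, ← h N]
    exact map_comp_congr_right F.mor.o (hom L δ) k
  · intro k
    change F.mor.o.map _ = F.mor.o.map _
    rw [h' M, h' N]
    exact map_comp_congr_right F.mor.o (hom L (genVars (minTheory_closed L Sg) Γ)) k

theorem inKer_seq (F : SgStructure.{u, v, w, p} L Sg) {Γ : List Sg.Srt}
    (φ ψ : Formula L Sg Γ) : F.InKer (.seq [φ] ψ) ↔
      F.mor.p _ (pred φ) ≤ F.mor.p _ (pred ψ) := by
  obtain ⟨δ, hδ⟩ := exists_comp_genVars (minTheory_closed L Sg) Γ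
  have h : ∀ φ : Formula L Sg Γ, (formulaCat L Sg).re (hom L δ)
      ((generic (minTheory_closed L Sg)).form φ) = pred φ := by
    intro φ
    rw [generic_form]
    refine congrArg pred ((φ.subst_subst _ _).trans ?_)
    rw [hδ, Formula.subst_id]
  have h' : ∀ φ : Formula L Sg Γ, (generic (minTheory_closed L Sg)).form φ =
      (formulaCat L Sg).re (hom L (genVars (minTheory_closed L Sg) Γ)) (pred φ) :=
    generic_form _
  have hs : F.InKer (.seq [φ] ψ) ↔ F.mor.p _ ((generic (minTheory_closed L Sg)).form φ) ≤
      F.mor.p _ ((generic (minTheory_closed L Sg)).form ψ) :=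
    iff_of_eq (congrArg (fun r => F.mor.p _ r ≤ _) (PropCat.tensList_singleton _ _ _))
  rw [hs]
  constructor
  · intro k
    rw [← h φ, ← h ψ]
    exact F.mor.re_le_re (hom L δ) k
  · intro k
    rw [h' φ, h' ψ]
    exact F.mor.re_le_re (hom L (genVars (minTheory_closed L Sg) Γ)) k

/-- If every assertion in the kernel of `G` is in the kernel of `F`, then `F` identifies all the
morphisms that `G` identifies: lists of terms are compared componentwise, because `F` preserves
finite products. -/
theorem map_eq_of_inKer {F G : SgStructure.{u, v, w, p} L Sg}
    (h : ∀ a, G.InKer a → F.InKer a) {Γ : List Sg.Srt} : ∀ {Δ : List Sg.Srt}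
      (f g : @Quiver.Hom (formulaCat L Sg).C _ Γ Δ), G.mor.o.map f = G.mor.o.map g →
        F.mor.o.map f = F.mor.o.map g
  | [], f, g, _ => by
    have : f = g := toUnit_unique (C := (formulaCat L Sg).C) f g
    rw [this]
  | σ :: Δ, f, g, k => by
    let a : (formulaCat L Sg).C := Δ
    let b : (formulaCat L Sg).C := [σ]
    have h₁ : F.mor.o.map (f ≫ fst a b) = F.mor.o.map (g ≫ fst a b) :=
      map_eq_of_inKer h (Δ := Δ) _ _ (map_comp_congr_left G.mor.o k (fst a b))
    have h₂ : F.mor.o.map (f ≫ snd a b) = F.mor.o.map (g ≫ snd a b) := by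
      have hM : ∀ m : @Quiver.Hom (formulaCat L Sg).C _ Γ b,
          ∃ M : Term Sg Γ σ, m = hom L M.single := fun m => by
        induction m using ClsHom.ind with | _ γ
        exact ⟨γ σ .zero, congrArg (hom L) (Subst.single_zero γ).symm⟩
      obtain ⟨M, hM'⟩ := hM (f ≫ snd a b)
      obtain ⟨N, hN'⟩ := hM (g ≫ snd a b)
      have := map_comp_congr_left G.mor.o k (snd a b)
      rw [hM', hN'] at this ⊢
      exact (F.inKer_eqn M N).1 (h _ ((G.inKer_eqn M N).2 this))
    exact map_eq_of_fst_of_snd F.mor.o h₁ h₂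

theorem le_of_inKer {F G : SgStructure.{u, v, w, p} L Sg} (h : ∀ a, G.InKer a → F.InKer a)
    {Γ : (formulaCat L Sg).C} (r r' : (formulaCat L Sg).Fib Γ)
    (k : G.mor.p Γ r ≤ G.mor.p Γ r') : F.mor.p Γ r ≤ F.mor.p Γ r' := by
  induction r using ClsFib.ind with | _ φ
  induction r' using ClsFib.ind with | _ ψ
  exact (F.inKer_seq φ ψ).1 (h _ ((G.inKer_seq φ ψ).2 k))

end SgStructure

/-! ### The image of a morphism of prop-categories -/

namespace Mor

section Image

variable {L : Language.{u}} {A : PropCat.{u, v₁, w₁, p₁} L} {B : PropCat.{u, v₂, w₂, p₂} L}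

/-- The objects of the image of `G`: the objects of its domain, lifted to a larger universe, because
the image of a structure has to live in the universes of the codomains of structures. -/
structure ImageObj (G : Mor A B) : Type (max v₁ v) where
  /-- the underlying object of the domain -/
  as : A.C

/-- The morphisms of the image of `G`: the morphisms of the codomain of `G` of the form `G f`. -/
def ImageHom (G : Mor A B) (c d : ImageObj.{u, v} G) : Type w₂ :=
  {g : G.o.obj c.as ⟶ G.o.obj d.as // ∃ f, G.o.map f = g}

instance imageCategory (G : Mor A B) : Category.{w₂} (ImageObj.{u, v} G) where
  Hom := ImageHom G
  id c := ⟨𝟙 _, 𝟙 _, G.o.map_id _⟩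
  comp f g := ⟨f.1 ≫ g.1, f.2.choose ≫ g.2.choose, by
    rw [G.o.map_comp, f.2.choose_spec, g.2.choose_spec]⟩
  id_comp f := Subtype.ext (Category.id_comp f.1)
  comp_id f := Subtype.ext (Category.comp_id f.1)
  assoc f g h := Subtype.ext (Category.assoc f.1 g.1 h.1)

/-- The corestriction of the base functor of `G` to its image. -/
def imageFunctor (G : Mor A B) : A.C ⥤ ImageObj.{u, v} G where
  obj c := ⟨c⟩
  map f := ⟨G.o.map f, f, rfl⟩
  map_id _ := Subtype.ext (G.o.map_id _)
  map_comp _ _ := Subtype.ext (G.o.map_comp _ _)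

theorem exists_imageFunctor_map {G : Mor A B} {c d : ImageObj.{u, v} G} (f : c ⟶ d) :
    ∃ f' : c.as ⟶ d.as, f = (imageFunctor.{u, v} G).map f' :=
  ⟨f.2.choose, Subtype.ext f.2.choose_spec.symm⟩

/-- The terminal object of the image. -/
def imageTerminal (G : Mor A B) : Limits.LimitCone (Functor.empty.{0} (ImageObj.{u, v} G)) where
  cone := Limits.asEmptyCone (C := ImageObj.{u, v} G) ⟨𝟙_ A.C⟩
  isLimit := Limits.IsTerminal.ofUniqueHom
    (fun c => (imageFunctor.{u, v} G).map (toUnit c.as))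
    (fun c f => by
      obtain ⟨f, rfl⟩ := exists_imageFunctor_map f
      exact congrArg _ (toUnit_unique _ _))

/-- The binary products of the image. -/
noncomputable def imageProd (G : Mor A B) (c d : ImageObj.{u, v} G) :
    Limits.LimitCone (Limits.pair c d) where
  cone := Limits.BinaryFan.mk (P := (⟨c.as ⊗ d.as⟩ : ImageObj.{u, v} G))
    ((imageFunctor.{u, v} G).map (fst c.as d.as)) ((imageFunctor.{u, v} G).map (snd c.as d.as))
  isLimit := Limits.BinaryFan.IsLimit.mk _
    (fun f g => (imageFunctor.{u, v} G).map (lift f.2.choose g.2.choose))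
    (fun f g => ((imageFunctor.{u, v} G).map_comp _ _).symm.trans
      (Subtype.ext ((congrArg G.o.map (lift_fst _ _)).trans f.2.choose_spec)))
    (fun f g => ((imageFunctor.{u, v} G).map_comp _ _).symm.trans
      (Subtype.ext ((congrArg G.o.map (lift_snd _ _)).trans g.2.choose_spec)))
    (fun {e} f g m hf hg => by
      apply Subtype.ext
      refine (cancel_mono (prodComparison G.o c.as d.as)).1 ?_
      change m.1 ≫ _ = G.o.map _ ≫ _
      have hf' : m.1 ≫ G.o.map (fst c.as d.as) = f.1 := congrArg Subtype.val hf
      have hg' : m.1 ≫ G.o.map (snd c.as d.as) = g.1 := congrArg Subtype.val hg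
      apply CartesianMonoidalCategory.hom_ext
      · rw [Category.assoc, Category.assoc, prodComparison_fst, ← G.o.map_comp, lift_fst,
          f.2.choose_spec, hf']
      · rw [Category.assoc, Category.assoc, prodComparison_snd, ← G.o.map_comp, lift_snd,
          g.2.choose_spec, hg'])

noncomputable instance imageCartesian (G : Mor A B) :
    CartesianMonoidalCategory (ImageObj.{u, v} G) :=
  CartesianMonoidalCategory.ofChosenFiniteProducts (imageTerminal G) (imageProd G)

/-- The fibre of the image: the predicates of the codomain of the form `G r`. -/
abbrev ImageFib (G : Mor A B) (c : A.C) : Type p₂ :=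
  {r : B.Fib (G.o.obj c) // ∃ r', G.p c r' = r}

/-- The corestriction of the fibrewise maps of `G` to its image. -/
def toImageFib (G : Mor A B) (c : A.C) (r : A.Fib c) : ImageFib G c := ⟨G.p c r, r, rfl⟩

theorem exists_toImageFib {G : Mor A B} {c : A.C} (r : ImageFib G c) :
    ∃ r', r = toImageFib G c r' :=
  ⟨r.2.choose, Subtype.ext r.2.choose_spec.symm⟩

theorem exists_toImageFib_family {G : Mor A B} {c : A.C} {ι : Type*} (r : ι → ImageFib G c) :
    ∃ r' : ι → A.Fib c, r = fun i => toImageFib G c (r' i) :=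
  ⟨fun i => (r i).2.choose, funext fun i => Subtype.ext (r i).2.choose_spec.symm⟩

/-- The fibre functor of the image. -/
def imageFibFunctor (G : Mor A B) : (ImageObj.{u, v} G)ᵒᵖ ⥤ PartOrd.{p₂} where
  obj c := PartOrd.of (ImageFib G c.unop.as)
  map {c d} f := PartOrd.ofHom
    ⟨fun r => ⟨B.re f.unop.1 r.1, A.re f.unop.2.choose r.2.choose, by
        rw [G.natural, f.unop.2.choose_spec, r.2.choose_spec]⟩,
      fun _ _ h => B.re_mono f.unop.1 h⟩
  map_id c := PartOrd.ext fun r => Subtype.ext (B.re_id _ _)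
  map_comp f g := PartOrd.ext fun r => Subtype.ext (B.re_comp _ _ _)

theorem imageFibFunctor_map (G : Mor A B) {c d : A.C} (f : c ⟶ d) (r : A.Fib d) :
    (imageFibFunctor.{u, v} G).map ((imageFunctor.{u, v} G).map f).op (toImageFib G d r) =
      toImageFib G c (A.re f r) :=
  Subtype.ext (G.natural f r).symm

/-- The connectives of the image. -/
def imageConn (G : Mor A B) (c : A.C) {n : ℕ} (k : L.Conn n) (r : Fin n → ImageFib G c) :
    ImageFib G c :=
  ⟨B.conn (G.o.obj c) k fun i => (r i).1, A.conn c k fun i => (r i).2.choose, by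
    rw [G.map_conn]
    exact congrArg _ (funext fun i => (r i).2.choose_spec)⟩

theorem imageConn_mk (G : Mor A B) (c : A.C) {n : ℕ} (k : L.Conn n) (r : Fin n → A.Fib c) :
    imageConn G c k (fun i => toImageFib G c (r i)) = toImageFib G c (A.conn c k r) :=
  Subtype.ext (G.map_conn c k r).symm

theorem imageConn_pair (G : Mor A B) (c : A.C) (k : L.Conn 2) (x y : A.Fib c) :
    imageConn G c k ![toImageFib G c x, toImageFib G c y] =
      toImageFib G c (A.conn c k ![x, y]) := by
  rw [← imageConn_mk]
  congr 1; funext i; fin_cases i <;> rfl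

theorem imageConn_nil (G : Mor A B) (c : A.C) (k : L.Conn 0) :
    imageConn G c k ![] = toImageFib G c (A.conn c k ![]) := by
  rw [← imageConn_mk]
  congr 1; funext i; exact i.elim0

/-- The quantifiers of the image, computed in the codomain of `G`. -/
noncomputable def imageQuant (G : Mor A B) (Q : L.Quant) (b c : A.C)
    (r : ImageFib G (b ⊗ c)) : ImageFib G b :=
  ⟨B.quant Q (G.o.obj b) (G.o.obj c) (B.re (inv (prodComparison G.o b c)) r.1),
    A.quant Q b c r.2.choose, by rw [G.map_quant, r.2.choose_spec]⟩

theorem imageQuant_mk (G : Mor A B) (Q : L.Quant) (b c : A.C) (r : A.Fib (b ⊗ c)) :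
    imageQuant G Q b c (toImageFib G (b ⊗ c) r) = toImageFib G b (A.quant Q b c r) :=
  Subtype.ext (G.map_quant Q b c r).symm

theorem image_lift (G : Mor A B) {b c d : A.C} (f : b ⟶ c) (g : b ⟶ d) :
    lift ((imageFunctor.{u, v} G).map f) ((imageFunctor.{u, v} G).map g) =
      (imageFunctor.{u, v} G).map (lift f g) := by
  apply CartesianMonoidalCategory.hom_ext
  · refine (lift_fst _ _).trans (Eq.trans ?_ ((imageFunctor.{u, v} G).map_comp _ (fst c d)))
    exact congrArg _ (lift_fst f g).symm
  · refine (lift_snd _ _).trans (Eq.trans ?_ ((imageFunctor.{u, v} G).map_comp _ (snd c d)))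
    exact congrArg _ (lift_snd f g).symm

theorem image_whiskerRight (G : Mor A B) {b b' : A.C} (f : b' ⟶ b) (c : A.C) :
    (imageFunctor.{u, v} G).map f ▷ (imageFunctor.{u, v} G).obj c =
      (imageFunctor.{u, v} G).map (f ▷ c) := by
  apply CartesianMonoidalCategory.hom_ext
  · refine (whiskerRight_fst _ _).trans ?_
    refine Eq.trans ?_ ((imageFunctor.{u, v} G).map_comp (f ▷ c) (fst b c))
    rw [whiskerRight_fst]
    exact ((imageFunctor.{u, v} G).map_comp (fst b' c) f).symm
  · refine (whiskerRight_snd _ _).trans ?_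
    refine Eq.trans ?_ ((imageFunctor.{u, v} G).map_comp (f ▷ c) (snd b c))
    rw [whiskerRight_snd]
    rfl

theorem image_associator_inv (G : Mor A B) (b c d : A.C) :
    (α_ ((imageFunctor.{u, v} G).obj b) ((imageFunctor.{u, v} G).obj c)
      ((imageFunctor.{u, v} G).obj d)).inv = (imageFunctor.{u, v} G).map (α_ b c d).inv := by
  let K := imageFunctor.{u, v} G
  apply CartesianMonoidalCategory.hom_ext
  · apply CartesianMonoidalCategory.hom_ext
    · refine (Category.assoc _ _ _).trans ((associator_inv_fst_fst _ _ _).trans ?_)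
      refine (congrArg K.map (associator_inv_fst_fst b c d)).symm.trans ?_
      refine (K.map_comp _ _).trans ?_
      exact (congrArg (fun f => K.map (α_ b c d).inv ≫ f) (K.map_comp _ _)).trans
        (Category.assoc _ _ _).symm
    · refine (Category.assoc _ _ _).trans ((associator_inv_fst_snd _ _ _).trans ?_)
      refine (K.map_comp (snd b (c ⊗ d)) (fst c d)).symm.trans ?_
      refine (congrArg K.map (associator_inv_fst_snd b c d)).symm.trans ?_
      refine (K.map_comp _ _).trans ?_
      exact (congrArg (fun f => K.map (α_ b c d).inv ≫ f) (K.map_comp _ _)).trans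
        (Category.assoc _ _ _).symm
  · refine (associator_inv_snd _ _ _).trans ?_
    refine (K.map_comp (snd b (c ⊗ d)) (snd c d)).symm.trans ?_
    refine (congrArg K.map (associator_inv_snd b c d)).symm.trans ?_
    exact K.map_comp _ _

theorem imageConn_tensor_assoc (G : Mor A B) (c : A.C) (x y z : ImageFib G c) :
    imageConn G c L.tensor ![imageConn G c L.tensor ![x, y], z] =
      imageConn G c L.tensor ![x, imageConn G c L.tensor ![y, z]] := by
  obtain ⟨x, rfl⟩ := exists_toImageFib x
  obtain ⟨y, rfl⟩ := exists_toImageFib y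
  obtain ⟨z, rfl⟩ := exists_toImageFib z
  simp only [imageConn_pair, A.tensor_assoc]

theorem imageConn_unit_tensor (G : Mor A B) (c : A.C) (x : ImageFib G c) :
    imageConn G c L.tensor ![imageConn G c L.unit ![], x] = x := by
  obtain ⟨x, rfl⟩ := exists_toImageFib x
  rw [imageConn_nil, imageConn_pair, A.unit_tensor]

theorem imageConn_tensor_unit (G : Mor A B) (c : A.C) (x : ImageFib G c) :
    imageConn G c L.tensor ![x, imageConn G c L.unit ![]] = x := by
  obtain ⟨x, rfl⟩ := exists_toImageFib x
  rw [imageConn_nil, imageConn_pair, A.tensor_unit]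

theorem imageFibFunctor_map_of_eq (G : Mor A B) {c d : A.C} {f : c ⟶ d}
    {g : (imageFunctor.{u, v} G).obj c ⟶ (imageFunctor.{u, v} G).obj d}
    (h : (imageFunctor.{u, v} G).map f = g) (r : A.Fib d) :
    (imageFibFunctor.{u, v} G).map g.op (toImageFib G d r) = toImageFib G c (A.re f r) := by
  subst h
  exact imageFibFunctor_map G f r

theorem image_lift_comp (G : Mor A B) {a a' b c d : A.C} (f : a ⟶ b) (f' : b ⟶ c) (g : a ⟶ a')
    (g' : a' ⟶ d) : (imageFunctor.{u, v} G).map (lift (f ≫ f') (g ≫ g')) =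
      lift ((imageFunctor.{u, v} G).map f ≫ (imageFunctor.{u, v} G).map f')
        ((imageFunctor.{u, v} G).map g ≫ (imageFunctor.{u, v} G).map g') := by
  rw [← Functor.map_comp, ← Functor.map_comp, image_lift]

theorem image_EqPred_prod (G : Mor A B) (c d : A.C) :
    toImageFib G ((c ⊗ d) ⊗ (c ⊗ d)) (A.EqPred (c ⊗ d)) =
      imageConn G ((c ⊗ d) ⊗ (c ⊗ d)) L.tensor
        ![(imageFibFunctor.{u, v} G).map (lift
            ((imageFunctor.{u, v} G).map (fst (c ⊗ d) (c ⊗ d)) ≫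
              (imageFunctor.{u, v} G).map (fst c d))
            ((imageFunctor.{u, v} G).map (snd (c ⊗ d) (c ⊗ d)) ≫
              (imageFunctor.{u, v} G).map (fst c d))).op (toImageFib G (c ⊗ c) (A.EqPred c)),
          (imageFibFunctor.{u, v} G).map (lift
            ((imageFunctor.{u, v} G).map (fst (c ⊗ d) (c ⊗ d)) ≫
              (imageFunctor.{u, v} G).map (snd c d))
            ((imageFunctor.{u, v} G).map (snd (c ⊗ d) (c ⊗ d)) ≫
              (imageFunctor.{u, v} G).map (snd c d))).op (toImageFib G (d ⊗ d) (A.EqPred d))] := by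
  rw [A.EqPred_prod, ← imageConn_pair]
  have h₁ := imageFibFunctor_map_of_eq.{u, v} G (image_lift_comp G
    (fst (c ⊗ d) (c ⊗ d)) (fst c d) (snd (c ⊗ d) (c ⊗ d)) (fst c d)) (A.EqPred c)
  have h₂ := imageFibFunctor_map_of_eq.{u, v} G (image_lift_comp G
    (fst (c ⊗ d) (c ⊗ d)) (snd c d) (snd (c ⊗ d) (c ⊗ d)) (snd c d)) (A.EqPred d)
  exact congrArg (imageConn G _ L.tensor) (congrArg₂ (fun x y => ![x, y]) h₁.symm h₂.symm)

theorem image_quant_natural (G : Mor A B) (Q : L.Quant) {b b' : A.C} (f : b' ⟶ b) (c : A.C)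
    (r : ImageFib G (b ⊗ c)) : imageQuant G Q b' c ((imageFibFunctor.{u, v} G).map
      ((imageFunctor.{u, v} G).map f ▷ (imageFunctor.{u, v} G).obj c).op r) =
        (imageFibFunctor.{u, v} G).map ((imageFunctor.{u, v} G).map f).op
          (imageQuant G Q b c r) := by
  obtain ⟨r, rfl⟩ := exists_toImageFib r
  refine (congrArg (imageQuant G Q b' c)
    (imageFibFunctor_map_of_eq G (image_whiskerRight G f c).symm r)).trans ?_
  rw [imageQuant_mk, imageQuant_mk, A.quant_natural]
  exact (imageFibFunctor_map G f _).symm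

theorem image_quant_prod (G : Mor A B) (Q : L.Quant) (b c d : A.C)
    (r : ImageFib G ((b ⊗ c) ⊗ d)) : imageQuant G Q b (c ⊗ d) ((imageFibFunctor.{u, v} G).map
      (α_ ((imageFunctor.{u, v} G).obj b) ((imageFunctor.{u, v} G).obj c)
        ((imageFunctor.{u, v} G).obj d)).inv.op r) =
      imageQuant G Q b c (imageQuant G Q (b ⊗ c) d r) := by
  obtain ⟨r, rfl⟩ := exists_toImageFib r
  refine (congrArg (imageQuant G Q b (c ⊗ d))
    (imageFibFunctor_map_of_eq G (image_associator_inv G b c d).symm r)).trans ?_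
  rw [imageQuant_mk, imageQuant_mk, imageQuant_mk, A.quant_prod]

/-- The image of a morphism `G` of prop-categories. Every equation between the operations holds in
it, since it holds in the domain of `G`. -/
noncomputable def image (G : Mor A B) : PropCat.{u, max v₁ v, w₂, p₂} L where
  C := ImageObj.{u, v} G
  P := imageFibFunctor G
  conn c _ k r := imageConn G c.as k r
  map_conn {c d} f n k r := by
    obtain ⟨f, rfl⟩ := exists_imageFunctor_map f
    obtain ⟨r, rfl⟩ := exists_toImageFib_family (G := G) r
    refine (congrArg _ (imageConn_mk G d.as k r)).trans ?_
    refine (imageFibFunctor_map G f _).trans ?_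
    refine (congrArg _ (A.map_conn f k r)).trans ((imageConn_mk G c.as k _).symm.trans ?_)
    exact congrArg _ (funext fun i => (imageFibFunctor_map G f (r i)).symm)
  EqPred c := toImageFib G (c.as ⊗ c.as) (A.EqPred c.as)
  quant Q b c r := imageQuant G Q b.as c.as r
  quant_natural Q {b b'} f c r := by
    obtain ⟨f, rfl⟩ := exists_imageFunctor_map f
    exact image_quant_natural G Q f c.as r
  tensor_assoc c := imageConn_tensor_assoc G c.as
  unit_tensor c := imageConn_unit_tensor G c.as
  tensor_unit c := imageConn_tensor_unit G c.as
  quant_one Q b r := by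
    obtain ⟨r, rfl⟩ := exists_toImageFib (G := G) (c := b.as) r
    refine (congrArg (imageQuant G Q b.as (𝟙_ A.C))
      (imageFibFunctor_map G (fst b.as (𝟙_ A.C)) r)).trans ?_
    exact (imageQuant_mk G Q _ _ _).trans (congrArg _ (A.quant_one Q b.as r))
  quant_prod Q b c d r := image_quant_prod G Q b.as c.as d.as r
  EqPred_one := (congrArg _ A.EqPred_one).trans (imageConn_nil G _ _).symm
  EqPred_prod c d := image_EqPred_prod G c.as d.as

theorem prodComparison_imageFunctor (G : Mor A B) (b c : A.C) :
    prodComparison (imageFunctor.{u, v} G) b c = 𝟙 ((imageFunctor.{u, v} G).obj (b ⊗ c)) := by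
  apply CartesianMonoidalCategory.hom_ext
  · exact (prodComparison_fst _ _ _).trans (Category.id_comp _).symm
  · exact (prodComparison_snd _ _ _).trans (Category.id_comp _).symm

theorem imageFunctor_preserves (G : Mor A B) :
    Limits.PreservesFiniteProducts (imageFunctor.{u, v} G) :=
  preservesFiniteProducts_of_comparison _
    ((toUnit_unique _ _ : 𝟙 (𝟙_ (ImageObj.{u, v} G)) =
      terminalComparison (imageFunctor.{u, v} G)) ▸
      (inferInstance : IsIso (𝟙 (𝟙_ (ImageObj.{u, v} G)))))
    fun b c => (prodComparison_imageFunctor G b c).symm ▸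
      (inferInstance : IsIso (𝟙 ((imageFunctor.{u, v} G).obj (b ⊗ c))))

/-- The corestriction of `G` to its image. -/
noncomputable def toImage (G : Mor A B) : Mor A (image.{u, v} G) where
  o := imageFunctor G
  preserves := imageFunctor_preserves G
  p c := ⟨toImageFib G c, fun _ _ h => (G.p c).monotone h⟩
  natural f r := (imageFibFunctor_map G f r).symm
  map_conn c _ k r := (imageConn_mk G c k r).symm
  map_quant Q b c r := by
    have := imageFunctor_preserves.{u, v} G
    refine (imageQuant_mk G Q b c r).symm.trans (congrArg (imageQuant G Q b c) ?_)
    refine ((image.{u, v} G).re_id ⟨b ⊗ c⟩ (toImageFib G (b ⊗ c) r)).symm.trans ?_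
    refine congrArg (fun f => (image.{u, v} G).re f (toImageFib G (b ⊗ c) r)) ?_
    refine IsIso.eq_inv_of_hom_inv_id (f := prodComparison (imageFunctor.{u, v} G) b c) ?_
    exact (Category.comp_id _).trans (prodComparison_imageFunctor G b c)
  map_EqPred c := by
    refine ((image.{u, v} G).re_id ⟨c ⊗ c⟩ (toImageFib G (c ⊗ c) (A.EqPred c))).symm.trans ?_
    exact congrArg (fun f => (image.{u, v} G).re f _) (prodComparison_imageFunctor G c c).symm

/-- The inclusion of the base of the image. -/
def imageInclusionFunctor (G : Mor A B) : ImageObj.{u, v} G ⥤ B.C where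
  obj c := G.o.obj c.as
  map f := f.1

theorem prodComparison_imageInclusionFunctor (G : Mor A B) (b c : ImageObj.{u, v} G) :
    prodComparison (imageInclusionFunctor.{u, v} G) b c = prodComparison G.o b.as c.as := by
  apply CartesianMonoidalCategory.hom_ext
  · exact (prodComparison_fst _ _ _).trans (prodComparison_fst G.o b.as c.as).symm
  · exact (prodComparison_snd _ _ _).trans (prodComparison_snd G.o b.as c.as).symm

theorem imageInclusionFunctor_preserves (G : Mor A B) :
    Limits.PreservesFiniteProducts (imageInclusionFunctor.{u, v} G) :=
  preservesFiniteProducts_of_comparison _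
    ((toUnit_unique _ _ : terminalComparison G.o =
      terminalComparison (imageInclusionFunctor.{u, v} G)) ▸
      (inferInstance : IsIso (terminalComparison G.o)))
    fun b c => (prodComparison_imageInclusionFunctor G b c).symm ▸
      (inferInstance : IsIso (prodComparison G.o b.as c.as))

theorem inv_prodComparison_imageInclusionFunctor (G : Mor A B) (b c : ImageObj.{u, v} G)
    [Limits.PreservesFiniteProducts (imageInclusionFunctor.{u, v} G)] :
    inv (prodComparison (imageInclusionFunctor.{u, v} G) b c) =
      inv (prodComparison G.o b.as c.as) :=
  have h₁ : IsIso (prodComparison (imageInclusionFunctor.{u, v} G) b c) := inferInstance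
  have h₂ : IsIso (prodComparison G.o b.as c.as) := inferInstance
  (@IsIso.inv_eq_inv _ _ _ _ _ _ h₁ h₂).2 (prodComparison_imageInclusionFunctor G b c)

/-- The inclusion of the image. -/
noncomputable def imageInclusion (G : Mor A B) : Mor (image.{u, v} G) B where
  o := imageInclusionFunctor G
  preserves := imageInclusionFunctor_preserves G
  p c := ⟨Subtype.val, fun _ _ h => h⟩
  natural f r := rfl
  map_conn c _ k r := rfl
  map_quant Q b c r := by
    have := imageInclusionFunctor_preserves.{u, v} G
    refine congrArg (fun f => B.quant Q _ _ (B.re f r.1)) ?_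
    exact (inv_prodComparison_imageInclusionFunctor G b c).symm
  map_EqPred c := by
    refine (G.map_EqPred c.as).trans ?_
    exact congrArg (fun f => B.re f (B.EqPred (G.o.obj c.as)))
      (prodComparison_imageInclusionFunctor G c c).symm

theorem imageInclusion_isSubprop (G : Mor A B) : (imageInclusion.{u, v} G).IsSubprop where
  faithful := ⟨fun h => Subtype.ext h⟩
  embedding _ _ _ := Iff.rfl

variable {E : PropCat.{u, v₃, w₃, p₃} L}

/-- Heterogeneous equality bridges the fibres over `F.o c` and `F'.o c`. -/
theorem ext_of_map_eq {F F' : Mor A E} (ho : F.o = F'.o)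
    (hp : ∀ c r, HEq (F.p c r) (F'.p c r)) : F = F' := by
  obtain ⟨o, p, _, _, _, _⟩ := F
  obtain ⟨o', p', _, _, _, _⟩ := F'
  obtain rfl : o = o' := ho
  obtain rfl : p = p' := funext fun c => OrderHom.ext _ _ (funext fun r => eq_of_heq (hp c r))
  rfl

theorem p_eq_of_eq {G : Mor A B} {F : Mor A E}
    (hp : ∀ {c : A.C} (r r' : A.Fib c), G.p c r ≤ G.p c r' → F.p c r ≤ F.p c r')
    {c : A.C} {r r' : A.Fib c} (h : G.p c r = G.p c r') : F.p c r = F.p c r' :=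
  le_antisymm (hp _ _ h.le) (hp _ _ h.ge)

section Desc

variable (G : Mor A B) (F : Mor A E)
  (ho : ∀ {c d : A.C} (f g : c ⟶ d), G.o.map f = G.o.map g → F.o.map f = F.o.map g)
  (hp : ∀ {c : A.C} (r r' : A.Fib c), G.p c r ≤ G.p c r' → F.p c r ≤ F.p c r')

/-- The functor induced on the image of `G` by `F`, if `F` identifies all the morphisms that `G`
identifies. -/
noncomputable def imageDescFunctor : ImageObj.{u, v} G ⥤ E.C where
  obj c := F.o.obj c.as
  map f := F.o.map f.2.choose
  map_id c := (ho _ _ ((𝟙 c : c ⟶ c).2.choose_spec.trans (G.o.map_id c.as).symm)).trans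
    (F.o.map_id c.as)
  map_comp f g := by
    rw [← F.o.map_comp]
    refine ho _ _ ((f ≫ g).2.choose_spec.trans ?_)
    rw [G.o.map_comp, f.2.choose_spec, g.2.choose_spec]
    rfl

theorem imageDescFunctor_map {c d : A.C} (f : c ⟶ d) :
    (imageDescFunctor.{u, v} G F ho).map ((imageFunctor.{u, v} G).map f) = F.o.map f :=
  ho _ _ ((imageFunctor.{u, v} G).map f).2.choose_spec

theorem prodComparison_imageDescFunctor (b c : ImageObj.{u, v} G) :
    prodComparison (imageDescFunctor.{u, v} G F ho) b c = prodComparison F.o b.as c.as := by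
  apply CartesianMonoidalCategory.hom_ext
  · refine (prodComparison_fst _ _ _).trans (Eq.trans ?_ (prodComparison_fst F.o b.as c.as).symm)
    exact imageDescFunctor_map G F ho _
  · refine (prodComparison_snd _ _ _).trans (Eq.trans ?_ (prodComparison_snd F.o b.as c.as).symm)
    exact imageDescFunctor_map G F ho _

theorem imageDescFunctor_preserves :
    Limits.PreservesFiniteProducts (imageDescFunctor.{u, v} G F ho) :=
  preservesFiniteProducts_of_comparison _
    ((toUnit_unique _ _ : terminalComparison F.o =
      terminalComparison (imageDescFunctor.{u, v} G F ho)) ▸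
      (inferInstance : IsIso (terminalComparison F.o)))
    fun b c => (prodComparison_imageDescFunctor G F ho b c).symm ▸
      (inferInstance : IsIso (prodComparison F.o b.as c.as))

theorem inv_prodComparison_imageDescFunctor (b c : ImageObj.{u, v} G)
    [Limits.PreservesFiniteProducts (imageDescFunctor.{u, v} G F ho)] :
    inv (prodComparison (imageDescFunctor.{u, v} G F ho) b c) =
      inv (prodComparison F.o b.as c.as) :=
  have h₁ : IsIso (prodComparison (imageDescFunctor.{u, v} G F ho) b c) := inferInstance
  have h₂ : IsIso (prodComparison F.o b.as c.as) := inferInstance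
  (@IsIso.inv_eq_inv _ _ _ _ _ _ h₁ h₂).2 (prodComparison_imageDescFunctor G F ho b c)

/-- The monotone maps induced on the fibres of the image of `G` by `F`, if the order relations that
hold in the image of `G` hold in the image of `F`. -/
noncomputable def imageDescFib (c : A.C) : ImageFib G c →o E.Fib (F.o.obj c) :=
  ⟨fun r => F.p c r.2.choose, fun r r' (h : r.1 ≤ r'.1) => hp _ _ (by
    rwa [r.2.choose_spec, r'.2.choose_spec])⟩

theorem imageDescFib_mk {c : A.C} (r : A.Fib c) :
    imageDescFib G F hp c (toImageFib G c r) = F.p c r :=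
  p_eq_of_eq hp (toImageFib G c r).2.choose_spec

theorem imageDescFib_natural {c d : A.C} (f : c ⟶ d) (r : ImageFib G d) :
    imageDescFib G F hp c
        ((imageFibFunctor.{u, v} G).map ((imageFunctor.{u, v} G).map f).op r) =
      E.re ((imageDescFunctor.{u, v} G F ho).map ((imageFunctor.{u, v} G).map f))
        (imageDescFib G F hp d r) := by
  obtain ⟨r, rfl⟩ := exists_toImageFib r
  refine (congrArg (imageDescFib G F hp c) (imageFibFunctor_map G f r)).trans ?_
  rw [imageDescFib_mk, imageDescFib_mk, F.natural, imageDescFunctor_map]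
  rfl

theorem imageDescFib_conn (c : A.C) {n : ℕ} (k : L.Conn n) (r : Fin n → ImageFib G c) :
    imageDescFib G F hp c (imageConn G c k r) =
      E.conn (F.o.obj c) k fun i => imageDescFib G F hp c (r i) := by
  obtain ⟨r, rfl⟩ := exists_toImageFib_family r
  simp only [imageConn_mk, imageDescFib_mk, F.map_conn]

theorem imageDescFib_quant (Q : L.Quant) (b c : A.C) (r : ImageFib G (b ⊗ c)) :
    imageDescFib G F hp b (imageQuant G Q b c r) = E.quant Q (F.o.obj b) (F.o.obj c)
      (E.re (inv (prodComparison F.o b c)) (imageDescFib G F hp (b ⊗ c) r)) := by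
  obtain ⟨r, rfl⟩ := exists_toImageFib r
  rw [imageQuant_mk, imageDescFib_mk, imageDescFib_mk, F.map_quant]

/-- The morphism induced on the image of `G` by `F`, if the kernel of `G` is contained in the kernel
of `F`. -/
noncomputable def imageDesc : Mor (image.{u, v} G) E where
  o := imageDescFunctor G F ho
  preserves := imageDescFunctor_preserves G F ho
  p c := imageDescFib G F hp c.as
  natural f r := by
    obtain ⟨f, rfl⟩ := exists_imageFunctor_map f
    exact imageDescFib_natural G F ho hp f r
  map_conn c _ k r := imageDescFib_conn G F hp c.as k r
  map_quant Q b c r := by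
    have := imageDescFunctor_preserves.{u, v} G F ho
    refine (imageDescFib_quant G F hp Q b.as c.as r).trans ?_
    exact congrArg (fun f => E.quant Q _ _ (E.re f (imageDescFib G F hp (b.as ⊗ c.as) r)))
      (inv_prodComparison_imageDescFunctor G F ho b c).symm
  map_EqPred c := by
    refine (imageDescFib_mk G F hp (A.EqPred c.as)).trans ((F.map_EqPred c.as).trans ?_)
    exact congrArg (fun f => E.re f (E.EqPred (F.o.obj c.as)))
      (prodComparison_imageDescFunctor G F ho c c).symm

theorem imageDesc_comp_toImage : (imageDesc.{u, v} G F ho hp).comp (toImage.{u, v} G) = F :=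
  ext_of_map_eq
    (CategoryTheory.Functor.hext (fun _ => rfl) fun _ _ f =>
      heq_of_eq (imageDescFunctor_map.{u, v} G F ho f))
    fun _ r => heq_of_eq (imageDescFib_mk G F hp r)

end Desc

end Image

end Mor

/-! ### The closure operators -/

section Closure

variable {L : Language.{u}} {𝓛 : Logic.{u, s} L} {Sg : Signature.{u}}

namespace SgStructure

theorem InKer.comp {D E : PropCat.{u, max u v, max u w, max u p} L} {F : Mor (formulaCat L Sg) D}
    (H : Mor D E) {a : Assertion L Sg} (h : InKer.{u, v, w, p} ⟨D, F⟩ a) :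
    InKer.{u, v, w, p} ⟨E, H.comp F⟩ a := by
  cases a with
  | eqn M N => exact congrArg H.o.map h
  | seq Φ ψ => exact (H.p _).monotone h

theorem InKer.of_comp {D E : PropCat.{u, max u v, max u w, max u p} L}
    {F : Mor (formulaCat L Sg) D} {ι : Mor D E} (hι : ι.IsSubprop) {a : Assertion L Sg}
    (h : InKer.{u, v, w, p} ⟨E, ι.comp F⟩ a) : InKer.{u, v, w, p} ⟨D, F⟩ a := by
  cases a with
  | eqn M N =>
    have := hι.faithful
    exact ι.o.map_injective h
  | seq Φ ψ => exact (hι.embedding _ _ _).1 h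

theorem inKer_pi {I : Type u} (F : I → SgStructure.{u, v, w, p} L Sg) {a : Assertion L Sg} :
    InKer.{u, v, w, p} ⟨PropCat.pi.{u, v, w, p} fun i => (F i).cod, Mor.pi fun i => (F i).mor⟩ a ↔
      ∀ i, (F i).InKer a := by
  cases a with
  | eqn M N => exact funext_iff
  | seq Φ ψ => exact Iff.rfl

end SgStructure

variable {T : Theory L Sg} {Y : Set (SgStructure.{u, v, w, p} L Sg)}

theorem ProdClosure.subset_mod (h : Y ⊆ Mod 𝓛 T) : ProdClosure Y ⊆ Mod 𝓛 T := by
  intro F hF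
  induction hF with
  | base hF => exact h hF
  | prod F _ ih =>
    exact ⟨PropCat.sound_pi _ fun i => (ih i).1,
      fun a ha => (SgStructure.inKer_pi F).2 fun i => (ih i).2 a ha⟩

theorem SubClosure.subset_mod (h : Y ⊆ Mod 𝓛 T) : SubClosure 𝓛 Y ⊆ Mod 𝓛 T := by
  intro F hF
  induction hF with
  | base hF => exact h hF
  | sub K ι _ hE hι _ ih => exact ⟨hE, fun a ha => (ih.2 a ha).of_comp hι⟩

theorem HomClosure.subset_mod (h : Y ⊆ Mod 𝓛 T) : HomClosure 𝓛 Y ⊆ Mod 𝓛 T := by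
  intro F hF
  induction hF with
  | base hF => exact h hF
  | img F H _ hE _ ih => exact ⟨hE, fun a ha => (ih.2 a ha).comp H⟩

/-- A structure whose kernel contains the kernel of `G` is a homomorphic image of a submodel of `G`,
namely of the image of `G`. -/
theorem mem_homClosure_of_inKer {F G : SgStructure.{u, v, w, p} L Sg} (hF : 𝓛.Sound F.cod)
    (hG : 𝓛.Sound G.cod) (hGY : G ∈ Y) (h : ∀ a, G.InKer a → F.InKer a) :
    F ∈ HomClosure 𝓛 (SubClosure 𝓛 Y) := by
  have hι := G.mor.imageInclusion_isSubprop
  have hE := hι.sound hG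
  -- The composite of the corestriction and the inclusion is `G` by definition.
  have hK : (⟨G.mor.image, G.mor.toImage⟩ : SgStructure.{u, v, w, p} L Sg) ∈ SubClosure 𝓛 Y :=
    .sub G.mor.toImage G.mor.imageInclusion hG hE hι (.base hGY)
  have hH := HomClosure.img G.mor.toImage (G.mor.imageDesc F.mor
    (SgStructure.map_eq_of_inKer h) (SgStructure.le_of_inKer h)) hE hF (.base hK)
  have hF' := Mor.imageDesc_comp_toImage.{u, v} G.mor F.mor
    (SgStructure.map_eq_of_inKer h) (SgStructure.le_of_inKer h)
  exact (congrArg (fun m => HomClosure 𝓛 (SubClosure 𝓛 Y) ⟨F.cod, m⟩) hF').mp hH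

/-- The common theory of `Y` is the theory of a single structure, a product of members of `Y`: one
counterexample is chosen for each assertion outside the theory. The assertions form a set because
the signature is small. -/
theorem exists_mem_prodClosure_inKer_iff (Y : Set (SgStructure.{u, v, w, p} L Sg)) :
    ∃ G ∈ ProdClosure Y, ∀ a, G.InKer a ↔ a ∈ Th Y := by
  have hex : ∀ a : {a : Assertion L Sg // a ∉ Th Y}, ∃ F ∈ Y, ¬ F.InKer a.1 := by
    intro a
    by_contra! h
    exact a.2 h
  choose F hF hFa using hex
  refine ⟨_, .prod F fun i => .base (hF i), fun a => (SgStructure.inKer_pi F).trans ⟨?_, ?_⟩⟩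
  · intro h
    by_contra ha
    exact hFa ⟨a, ha⟩ (h _)
  · exact fun ha i => ha _ (hF i)

end Closure

end FibHSP

theorem mainTheorem1 (L : FibHSP.Language.{u}) (𝓛 : FibHSP.Logic.{u, s} L)
    (Sg : FibHSP.Signature.{u}) (Y : Set (FibHSP.SgStructure.{u, v, w, p} L Sg))
    (hY : Y ⊆ FibHSP.AllStr 𝓛 Sg) :
    FibHSP.Mod 𝓛 (FibHSP.Th Y) =
      FibHSP.HomClosure 𝓛 (FibHSP.SubClosure 𝓛 (FibHSP.ProdClosure Y)) := by
  have hP : FibHSP.ProdClosure Y ⊆ FibHSP.Mod 𝓛 (FibHSP.Th Y) :=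
    FibHSP.ProdClosure.subset_mod fun F hF => ⟨hY hF, fun a ha => ha F hF⟩
  apply Set.Subset.antisymm
  · intro F hF
    obtain ⟨G, hGP, hG⟩ := FibHSP.exists_mem_prodClosure_inKer_iff Y
    exact FibHSP.mem_homClosure_of_inKer hF.1 (hP hGP).1 hGP fun a ha => hF.2 a ((hG a).1 ha)
  · exact FibHSP.HomClosure.subset_mod (FibHSP.SubClosure.subset_mod hP)
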